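/- All schemes are over $\mathbb{C}$. For a fan $\Sigma$ in $\mathbb{R}^d$ (with lattice $\mathbb{Z}^d$), let $\Sigma(1)$ be its set of rays, $u_\rho$ the primitive generator of $\rho\in\Sigma(1)$, $\iota:\mathbb{Z}^d\to\mathbb{Z}^{\Sigma(1)}$ the map $m\mapsto(\langle m,u_\rho\rangle)_\rho$, $G_\Sigma=\mathrm{Hom}_{\mathbb{Z}}(\mathrm{coker}\,\iota,\mathbb{C}^*)\subseteq(\mathbb{C}^*)^{\Sigma(1)}$ its Cox group, $U_\Sigma=\bigcup_{\sigma\in\Sigma}\{x\in\mathbb{C}^{\Sigma(1)}: x_\rho\ne0 \text{ for every ray } \rho \text{ that is not a face of } \sigma\}$ its Cox open set, and $\mathcal{X}_\Sigma=[U_\Sigma/G_\Sigma]$ its Cox stack, where $G_\Sigma$ acts by rescaling coordinates. Let $$\begin{aligned}u_0&=(3,0,0,-1,-1),& u_1&=(0,3,0,-1,-1),& u_2&=(0,0,3,-1,-1),\\ u_3&=(-1,-1,-1,3,0),& u_4&=(-1,-1,-1,0,3),& u_5&=(-1,-1,-1,0,0)\end{aligned}$$ in $\mathbb{Z}^5$,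 and let $\Sigma_{LT}$ consist of the cones generated by five of these six vectors, together with all their faces. Let $\zeta_3,\zeta_9$ be primitive third and ninth roots of unity, and let $G_{81}\subset(\mathbb{C}^*)^6$ be the group generated by the elements $$g_{\alpha,\beta,\delta,\varepsilon,\mu}=(\zeta_3^{\alpha}\zeta_9^{\mu},\ \zeta_3^{\beta}\zeta_9^{\mu},\ \zeta_9^{\mu},\ \zeta_3^{-\delta}\zeta_9^{-\mu},\ \zeta_3^{-\varepsilon}\zeta_9^{-\mu},\ \zeta_9^{-\mu}),$$ where $\alpha,\beta,\delta,\varepsilon,\mu\in\mathbb{Z}$ satisfy $\zeta_9^{3\mu}=\zeta_3^{\alpha+\beta}=\zeta_3^{\delta+\varepsilon}$. **Proposition.** $\Sigma_{LT}$ is a fan. Its maximal cones are the cones generated by five of the vectors $u_0,\dots,u_5$, and its rays are the six cones $\rho_i=\mathrm{Cone}(u_i)$, with primitive generators $u_i$. Identify $\Sigma_{LT}(1)$ with $\{0,\dots,5\}$ accordingly. Then: 1. $U_{\Sigma_{LT}}=\mathbb{C}^6\setminus\{0\}$. 2. The map $(c,g)\mapsto(c\,g_0,\dots,c\,g_5)$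 is an isomorphism $\mathbb{C}^*\times G_{81}\cong G_{\Sigma_{LT}}$, both of abstract groups and of group schemes (with $G_{81}$ a constant group scheme). 3. $G_{81}\cong(\mathbb{Z}/3)^2\times\mathbb{Z}/9$. 4. The Cox stack $\mathcal{X}_{\Sigma_{LT}}$ is isomorphic, as a stack over $\mathbb{C}$, to $[(\mathbb{C}^6\setminus\{0\})/(\mathbb{C}^*\times G_{81})]$, where $(c,g)$ acts by $x_i\mapsto c\,g_i\,x_i$. -/

import Mathlib

open CategoryTheory AlgebraicGeometry Opposite

noncomputable section

/-! ## Fans in `ℝ^d` with the lattice `ℤ^d` -/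

/-- A lattice vector, viewed in `ℝ^d`. -/
def realVec {d : ℕ} (u : Fin d → ℤ) : Fin d → ℝ := fun i => (u i : ℝ)

/-- The cone `Cone(u_i | i ∈ I)` generated by a family of lattice vectors. -/
def latticeCone {d : ℕ} {J : Type} (u : J → Fin d → ℤ) (I : Set J) :
    PointedCone ℝ (Fin d → ℝ) :=
  PointedCone.hull ℝ ((fun i => realVec (u i)) '' I)

/-- A fan: a finite collection of strongly convex rational polyhedral cones, closed under taking
faces, in which any two cones meet along a common face. -/
structure IsFan {d : ℕ} (F : Set (PointedCone ℝ (Fin d → ℝ))) : Prop where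
  finite : F.Finite
  rational : ∀ σ ∈ F, ∃ A : Set (Fin d → ℤ), A.Finite ∧ σ = latticeCone id A
  strongly_convex : ∀ σ ∈ F, (σ : ConvexCone ℝ (Fin d → ℝ)).Salient
  face_mem : ∀ σ ∈ F, ∀ τ : PointedCone ℝ (Fin d → ℝ), τ.IsFaceOf σ → τ ∈ F
  inter_face : ∀ σ ∈ F, ∀ τ ∈ F, (σ ⊓ τ).IsFaceOf σ ∧ (σ ⊓ τ).IsFaceOf τ

/-- The set `Σ(1)` of rays of a fan: its one-dimensional cones. -/
def rays {d : ℕ} (F : Set (PointedCone ℝ (Fin d → ℝ))) : Set (PointedCone ℝ (Fin d → ℝ)) :=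
  {ρ | ρ ∈ F ∧ Module.finrank ℝ (Submodule.span ℝ (ρ : Set (Fin d → ℝ))) = 1}

/-- `u` is the primitive generator of the ray `ρ`: it generates `ρ` and is not a proper multiple
of a lattice vector. -/
def IsPrimGen {d : ℕ} (ρ : PointedCone ℝ (Fin d → ℝ)) (u : Fin d → ℤ) : Prop :=
  ρ = PointedCone.hull ℝ {realVec u} ∧ ∀ (k : ℤ) (v : Fin d → ℤ), u = k • v → IsUnit k

/-- The primitive generator `u_ρ` of a rational ray `ρ`. -/
def primGen {d : ℕ} (ρ : PointedCone ℝ (Fin d → ℝ)) : Fin d → ℤ :=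
  Classical.epsilon (IsPrimGen ρ)

/-! ## The Cox group -/

/-- The map `ι(m) = div(χ^m) = ∑_ρ ⟨m, u_ρ⟩ D_ρ` from the dual lattice to `ℤ^{Σ(1)}`. -/
def divMap {d : ℕ} (F : Set (PointedCone ℝ (Fin d → ℝ))) :
    (Fin d → ℤ) →+ (rays F → ℤ) where
  toFun m ρ := ∑ i, m i * primGen ρ.1 i
  map_zero' := by
    funext ρ
    simp
  map_add' m m' := by
    funext ρ
    simp [add_mul, Finset.sum_add_distrib]

/-- The cokernel of `ι`. -/
abbrev divCoker {d : ℕ} (F : Set (PointedCone ℝ (Fin d → ℝ))) : Type :=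
  (rays F → ℤ) ⧸ (divMap F).range

open scoped Classical in
/-- The class of the divisor `D_ρ` in `coker ι`. -/
def divClass {d : ℕ} (F : Set (PointedCone ℝ (Fin d → ℝ))) (ρ : rays F) : divCoker F :=
  QuotientAddGroup.mk (Pi.single ρ 1)

/-- `Hom_ℤ(coker ι, A)` for a multiplicatively written abelian group `A`. For `A = ℂˣ` this is the
Cox group `G_Σ`. -/
abbrev CoxGroup {d : ℕ} (F : Set (PointedCone ℝ (Fin d → ℝ))) (A : Type) [CommGroup A] : Type :=
  Multiplicative (divCoker F) →* A

/-- The coordinates of an element of `G_Σ` under `G_Σ → (ℂˣ)^{Σ(1)}`. -/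
def coxCoord {d : ℕ} (F : Set (PointedCone ℝ (Fin d → ℝ))) (A : Type) [CommGroup A] :
    CoxGroup F A →* (rays F → A) where
  toFun g ρ := g (Multiplicative.ofAdd (divClass F ρ))
  map_one' := rfl
  map_mul' _ _ := rfl

/-! ## Complex schemes, group functors and their actions -/

/-- The category of schemes over `ℂ`. -/
abbrev SchC : Type 1 := Over (Spec (CommRingCat.of ℂ))

/-- The ring `𝒪(T)` of global functions. -/
abbrev fns (T : SchC) : Type := Γ(T.left, ⊤)

/-- Pullback of global functions. -/
def pull {T T' : SchC} (f : T' ⟶ T) : fns T →+* fns T' := f.left.appTop.hom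

lemma pull_id (T : SchC) : pull (𝟙 T) = RingHom.id (fns T) := by
  ext x
  simp [pull]

lemma pull_comp {T T' T'' : SchC} (f : T' ⟶ T) (g : T'' ⟶ T') :
    pull (g ≫ f) = (pull g).comp (pull f) := by
  ext x
  simp only [pull, Over.comp_left, Scheme.Hom.comp_appTop, CommRingCat.hom_comp]

/-- The structure map `ℂ → 𝒪(T)`. -/
def constFn (T : SchC) : ℂ →+* fns T :=
  ((Scheme.ΓSpecIso (CommRingCat.of ℂ)).inv ≫ T.hom.appTop).hom

/-- A presheaf of groups on complex schemes; a group scheme is treated through its functor of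
points. -/
abbrev GroupFunctor : Type 1 := SchCᵒᵖ ⥤ GrpCat.{0}

/-- The torus `𝔾_m^n`. -/
def torus (n : Type) : GroupFunctor where
  obj T := GrpCat.of (n → (fns T.unop)ˣ)
  map f := GrpCat.ofHom
    { toFun := fun t i => Units.map (pull f.unop).toMonoidHom (t i)
      map_one' := by
        funext i
        simp
      map_mul' := fun s t => by
        funext i
        simp }
  map_id T := by
    ext t i
    simp [pull_id]
  map_comp f g := by
    ext t i
    simp [pull_comp]

/-- The group scheme `Hom_ℤ(coker ι, 𝔾_m)` attached to `G_Σ`, i.e. `Spec ℂ[coker ι]`. -/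
def coxGroupFunctor {d : ℕ} (F : Set (PointedCone ℝ (Fin d → ℝ))) : GroupFunctor where
  obj T := GrpCat.of (CoxGroup F (fns T.unop)ˣ)
  map f := GrpCat.ofHom (MonoidHom.compHom (Units.map (pull f.unop).toMonoidHom))
  map_id T := by
    refine GrpCat.hom_ext (MonoidHom.ext fun t => MonoidHom.ext fun c => Units.ext ?_)
    change pull (𝟙 T.unop) _ = _
    rw [pull_id]
    rfl
  map_comp f g := by
    refine GrpCat.hom_ext (MonoidHom.ext fun t => MonoidHom.ext fun c => Units.ext ?_)
    change pull (g.unop ≫ f.unop) _ = _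
    rw [pull_comp]
    rfl

/-- The homomorphism `G_Σ → 𝔾_m^{Σ(1)}`. -/
def coxWeights {d : ℕ} (F : Set (PointedCone ℝ (Fin d → ℝ))) :
    coxGroupFunctor F ⟶ torus (rays F) where
  app T := GrpCat.ofHom (coxCoord F (fns T.unop)ˣ)
  naturality _ _ _ := rfl

/-- An action of a group functor on a presheaf of sets. -/
structure GAction (G : GroupFunctor) (X : SchCᵒᵖ ⥤ Type) where
  smul : ∀ T : SchCᵒᵖ, G.obj T → X.obj T → X.obj T
  one_smul : ∀ T (x : X.obj T), smul T 1 x = x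
  mul_smul : ∀ T (g h : G.obj T) (x : X.obj T), smul T (g * h) x = smul T g (smul T h x)
  map_smul : ∀ {T T' : SchCᵒᵖ} (f : T ⟶ T') (g : G.obj T) (x : X.obj T),
    X.map f (smul T g x) = smul T' (G.map f g) (X.map f x)

/-! ## Quotient stacks -/

/-- An object of the quotient stack `[X/G]`: a principal `G`-bundle `P → T` over a complex scheme
`T`, together with a `G`-equivariant map `P → X`. A principal bundle is an fppf morphism with a
`G`-action along its fibres for which `G × P → P ×_T P` is an isomorphism; the last condition is
expressed on points. -/
structure QuotObj (G : GroupFunctor) (X : SchCᵒᵖ ⥤ Type) (a : GAction G X) where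
  base : SchC
  total : SchC
  proj : total ⟶ base
  act : GAction G (yoneda.obj total)
  act_proj : ∀ (T : SchC) (g : G.obj (op T)) (p : T ⟶ total),
    (act.smul (op T) g p : T ⟶ total) ≫ proj = p ≫ proj
  flat : Flat proj.left
  surjective : Surjective proj.left
  finitePresentation : LocallyOfFinitePresentation proj.left
  simply_transitive : ∀ (T : SchC) (p q : T ⟶ total), p ≫ proj = q ≫ proj →
    ∃! g : G.obj (op T), act.smul (op T) g p = q
  toX : yoneda.obj total ⟶ X
  equivariant : ∀ (T : SchC) (g : G.obj (op T)) (p : T ⟶ total),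
    toX.app (op T) (act.smul (op T) g p) = a.smul (op T) g (toX.app (op T) p)

/-- A morphism in `[X/G]`: a cartesian square whose upper arrow is `G`-equivariant and compatible
with the maps to `X`. -/
@[ext]
structure QuotHom {G : GroupFunctor} {X : SchCᵒᵖ ⥤ Type} {a : GAction G X}
    (P Q : QuotObj G X a) where
  onBase : P.base ⟶ Q.base
  onTotal : P.total ⟶ Q.total
  cartesian : IsPullback onTotal P.proj Q.proj onBase
  equivariant : ∀ (T : SchC) (g : G.obj (op T)) (p : T ⟶ P.total),
    (P.act.smul (op T) g p : T ⟶ P.total) ≫ onTotal = Q.act.smul (op T) g (p ≫ onTotal)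
  comp_toX : yoneda.map onTotal ≫ Q.toX = P.toX

instance {G : GroupFunctor} {X : SchCᵒᵖ ⥤ Type} {a : GAction G X} :
    Category (QuotObj G X a) where
  Hom P Q := QuotHom P Q
  id P :=
    { onBase := 𝟙 _
      onTotal := 𝟙 _
      cartesian := IsPullback.of_horiz_isIso ⟨by simp⟩
      equivariant := by simp
      comp_toX := by simp }
  comp {P Q R} f g :=
    { onBase := f.onBase ≫ g.onBase
      onTotal := f.onTotal ≫ g.onTotal
      cartesian := f.cartesian.paste_horiz g.cartesian
      equivariant := fun T h p => by
        rw [← Category.assoc, f.equivariant, g.equivariant, Category.assoc]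
      comp_toX := by rw [Functor.map_comp, Category.assoc, g.comp_toX, f.comp_toX] }
  id_comp f := QuotHom.ext (Category.id_comp _) (Category.id_comp _)
  comp_id f := QuotHom.ext (Category.comp_id _) (Category.comp_id _)
  assoc f g h := QuotHom.ext (Category.assoc _ _ _) (Category.assoc _ _ _)

/-- The quotient stack `[X/G]`, as a category over the category of complex schemes. -/
def quotStack (G : GroupFunctor) (X : SchCᵒᵖ ⥤ Type) (a : GAction G X) : BasedCategory SchC :=
  BasedCategory.ofFunctor (𝒳 := QuotObj G X a)
    { obj := fun P => P.base
      map := fun f => QuotHom.onBase f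
      map_id := fun _ => rfl
      map_comp := fun _ _ => rfl }

/-- Two categories over complex schemes are isomorphic as stacks: there is a functor between them
over the base which is an equivalence of categories. -/
def IsStackIso (A B : BasedCategory SchC) : Prop :=
  ∃ Φ : BasedFunctor A B, Φ.toFunctor.IsEquivalence

/-! ## Torus-invariant open subschemes of affine space -/

/-- The coordinate open subset of `𝔸^n` attached to a collection `𝒮` of finite sets of indices:
the union over `s ∈ 𝒮` of the loci where `∏_{i ∈ s} x_i` is invertible. -/
def coordOpen {n : Type} (𝒮 : Set (Finset n)) :
    (𝔸(n; Spec (CommRingCat.of ℂ)) : Scheme.{0}).Opens :=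
  ⨆ s ∈ 𝒮, Scheme.basicOpen _ (∏ i ∈ s, AffineSpace.coord (Spec (CommRingCat.of ℂ)) i)

/-- The morphism `T → 𝔸^n` with given coordinate functions. -/
def toAffine {n : Type} (T : SchC) (x : n → fns T) : T.left ⟶ 𝔸(n; Spec (CommRingCat.of ℂ)) :=
  AffineSpace.homOfVector T.hom x

lemma pull_toAffine {n : Type} {T T' : SchC} (f : T' ⟶ T) (x : n → fns T) :
    toAffine T' (fun i => pull f (x i)) = f.left ≫ toAffine T x := by
  rw [toAffine, toAffine, AffineSpace.comp_homOfVector, Over.w]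
  rfl

lemma preimage_coordOpen {n : Type} (𝒮 : Set (Finset n)) (T : SchC) (x : n → fns T) :
    toAffine T x ⁻¹ᵁ coordOpen 𝒮 = ⨆ s ∈ 𝒮, T.left.basicOpen (∏ i ∈ s, x i) := by
  simp only [coordOpen, Scheme.Hom.preimage_iSup, Scheme.Hom.preimage_basicOpen_top, map_prod]
  simp only [toAffine, AffineSpace.homOfVector_appTop_coord]

lemma preimage_coordOpen_smul {n : Type} (𝒮 : Set (Finset n)) (T : SchC) (t : n → (fns T)ˣ)
    (x : n → fns T) :
    toAffine T (fun i => t i * x i) ⁻¹ᵁ coordOpen 𝒮 = toAffine T x ⁻¹ᵁ coordOpen 𝒮 := by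
  simp only [preimage_coordOpen, Finset.prod_mul_distrib, Scheme.basicOpen_mul]
  congr! 4 with s hs
  rw [Scheme.basicOpen_of_isUnit]
  · simp
  · rw [← Units.coe_prod]
    exact Units.isUnit _

/-- The functor of points of `coordOpen 𝒮`: its `T`-points are the coordinate tuples for which
the morphism `T → 𝔸^n` factors through the open subset. -/
def coordOpenPts {n : Type} (𝒮 : Set (Finset n)) : SchCᵒᵖ ⥤ Type where
  obj T := {x : n → fns T.unop // toAffine T.unop x ⁻¹ᵁ coordOpen 𝒮 = ⊤}
  map f := TypeCat.ofHom fun x => ⟨fun i => pull f.unop (x.1 i), by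
    rw [pull_toAffine, Scheme.Hom.comp_preimage, x.2]
    rfl⟩
  map_id T := by
    ext x i
    simp [pull_id]
  map_comp f g := by
    ext x i
    simp [pull_comp]

/-- The components of a homomorphism `w : G → 𝔾_m^n`. -/
def weight {n : Type} {G : GroupFunctor} (w : G ⟶ torus n) (T : SchCᵒᵖ) :
    G.obj T →* (n → (fns T.unop)ˣ) := (w.app T).hom

/-- A homomorphism `w : G → 𝔾_m^n` makes `G` act on `coordOpen 𝒮` by rescaling the coordinates. -/
def scaleAction {n : Type} {G : GroupFunctor} (w : G ⟶ torus n) (𝒮 : Set (Finset n)) :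
    GAction G (coordOpenPts 𝒮) where
  smul T g x := ⟨fun i => weight w T g i * x.1 i, by
    rw [preimage_coordOpen_smul, x.2]⟩
  one_smul T x := by
    refine Subtype.ext ?_
    funext i
    simp
  mul_smul T g h x := by
    refine Subtype.ext ?_
    funext i
    simp [mul_assoc]
  map_smul {T T'} f g x := by
    refine Subtype.ext ?_
    funext i
    have h : weight w T' (G.map f g) = (torus n).map f (weight w T g) :=
      ConcreteCategory.congr_hom (w.naturality f) g
    rw [h]
    exact map_mul (pull f.unop) _ _

/-! ## The Cox stack -/

/-- The complements `{ρ ∈ Σ(1) | ρ ∉ σ(1)}` of the sets of rays of the cones `σ ∈ Σ`. Then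
`coordOpen (coxSets F)` is the Cox open set
`U_Σ = ⋃_σ {∏_{ρ ∉ σ(1)} x_ρ ≠ 0} = 𝔸^{Σ(1)} ∖ Z(Σ)`: the `σ`-th piece is the affine toric variety of
the cone `Cone(e_ρ | ρ ∈ σ(1))` of the Cox fan. -/
def coxSets {d : ℕ} (F : Set (PointedCone ℝ (Fin d → ℝ))) : Set (Finset (rays F)) :=
  {s | ∃ σ ∈ F, ∀ ρ : rays F, ρ ∈ s ↔ ¬ ρ.1.IsFaceOf σ}

/-- The Cox stack `[U_Σ/G_Σ]`. -/
def coxStack {d : ℕ} (F : Set (PointedCone ℝ (Fin d → ℝ))) : BasedCategory SchC :=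
  quotStack (coxGroupFunctor F) (coordOpenPts (coxSets F)) (scaleAction (coxWeights F) (coxSets F))

/-! ## The Libgober–Teitelbaum fan and group -/

/-- The vectors `u_{ρ_0}, …, u_{ρ_5}`. -/
def ltVec : Fin 6 → Fin 5 → ℤ :=
  ![![3, 0, 0, -1, -1], ![0, 3, 0, -1, -1], ![0, 0, 3, -1, -1],
    ![-1, -1, -1, 3, 0], ![-1, -1, -1, 0, 3], ![-1, -1, -1, 0, 0]]

/-- `Σ_LT`: the cones generated by five of the six vectors, and all their faces. -/
def ltFan : Set (PointedCone ℝ (Fin 5 → ℝ)) :=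
  {τ | ∃ I : Finset (Fin 6), I.card = 5 ∧ τ.IsFaceOf (latticeCone ltVec I)}

/-- The diagonal matrix `g_{α,β,δ,ε,μ}`, given by its diagonal entries. -/
def ltElt (ζ₃ ζ₉ : ℂˣ) (α β δ ε μ : ℤ) : Fin 6 → ℂˣ :=
  ![ζ₃ ^ α * ζ₉ ^ μ, ζ₃ ^ β * ζ₉ ^ μ, ζ₉ ^ μ,
    ζ₃ ^ (-δ) * ζ₉ ^ (-μ), ζ₃ ^ (-ε) * ζ₉ ^ (-μ), ζ₉ ^ (-μ)]

/-- The group `G_81` of diagonal matrices generated by the `g_{α,β,δ,ε,μ}` with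
`ζ₉^{3μ} = ζ₃^{α+β} = ζ₃^{δ+ε}`. -/
def G81 (ζ₃ ζ₉ : ℂˣ) : Subgroup (Fin 6 → ℂˣ) :=
  Subgroup.closure {g | ∃ α β δ ε μ : ℤ, ζ₉ ^ (3 * μ) = ζ₃ ^ (α + β) ∧
    ζ₉ ^ (3 * μ) = ζ₃ ^ (δ + ε) ∧ g = ltElt ζ₃ ζ₉ α β δ ε μ}

/-- `t` agrees on the open set `V` with the constant tuple `h`. -/
def IsConstOn {n : Type} (T : SchC) (t : n → (fns T)ˣ) (h : n → ℂˣ) (V : T.left.Opens) : Prop :=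
  ∀ i, T.left.presheaf.map (homOfLE (le_top : V ≤ ⊤)).op (t i : fns T) =
    T.left.presheaf.map (homOfLE (le_top : V ≤ ⊤)).op (constFn T (h i))

lemma IsConstOn.mono {n : Type} {T : SchC} {t : n → (fns T)ˣ} {h : n → ℂˣ} {V W : T.left.Opens}
    (e : IsConstOn T t h V) (hW : W ≤ V) : IsConstOn T t h W := by
  intro i
  have := congrArg (T.left.presheaf.map (homOfLE hW).op) (e i)
  rwa [← CommRingCat.comp_apply, ← CommRingCat.comp_apply, ← Functor.map_comp] at this

lemma pull_constFn {T T' : SchC} (f : T' ⟶ T) (c : ℂ) : pull f (constFn T c) = constFn T' c := by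
  have h : T'.hom.appTop = T.hom.appTop ≫ f.left.appTop := by
    rw [← Scheme.Hom.comp_appTop, Over.w]
  have h' := congrArg
    (fun k => ((Scheme.ΓSpecIso (CommRingCat.of ℂ)).inv ≫ k).hom c) h
  exact h'.symm

/-- The `T`-points of the constant group scheme of a group `H` of diagonal matrices, embedded in
`𝔾_m^n`: the tuples of invertible functions that are locally on `T` a constant element of `H`. -/
def constPts {n : Type} (H : Subgroup (n → ℂˣ)) (T : SchC) : Subgroup (n → (fns T)ˣ) where
  carrier := {t | ∀ p : T.left, ∃ V : T.left.Opens, p ∈ V ∧ ∃ h ∈ H, IsConstOn T t h V}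
  one_mem' p := ⟨⊤, trivial, 1, H.one_mem, fun i => by simp⟩
  mul_mem' {s t} hs ht p := by
    obtain ⟨V, hV, h, hh, e⟩ := hs p
    obtain ⟨W, hW, k, hk, e'⟩ := ht p
    refine ⟨V ⊓ W, ⟨hV, hW⟩, h * k, H.mul_mem hh hk, fun i => ?_⟩
    have e₁ := IsConstOn.mono e (inf_le_left : V ⊓ W ≤ V) i
    have e₂ := IsConstOn.mono e' (inf_le_right : V ⊓ W ≤ W) i
    simp only [Pi.mul_apply, Units.val_mul, map_mul, e₁, e₂]
  inv_mem' {s} hs p := by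
    obtain ⟨V, hV, h, hh, e⟩ := hs p
    refine ⟨V, hV, h⁻¹, H.inv_mem hh, fun i => ?_⟩
    let r := (T.left.presheaf.map (homOfLE (le_top : V ≤ ⊤)).op).hom
    have e₁ : Units.map r.toMonoidHom (s i) =
        Units.map (r.comp (constFn T)).toMonoidHom (h i) := Units.ext (e i)
    have e₂ : Units.map r.toMonoidHom (s i)⁻¹ =
        Units.map (r.comp (constFn T)).toMonoidHom (h i)⁻¹ := by
      rw [map_inv, map_inv, e₁]
    exact congrArg Units.val e₂

lemma constPts_pull {n : Type} (H : Subgroup (n → ℂˣ)) {T T' : SchC} (f : T' ⟶ T)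
    {t : n → (fns T)ˣ} (ht : t ∈ constPts H T) :
    (fun i => Units.map (pull f).toMonoidHom (t i)) ∈ constPts H T' := by
  intro p
  obtain ⟨V, hV, h, hh, e⟩ := ht (f.left p)
  refine ⟨f.left ⁻¹ᵁ V, hV, h, hh, fun i => ?_⟩
  have e₁ := congrArg (f.left.app V) (e i)
  rw [← CommRingCat.comp_apply, ← CommRingCat.comp_apply, Scheme.Hom.naturality] at e₁
  rw [← pull_constFn f]
  exact e₁

/-- The group scheme `𝔾_m × H`, with `H` a constant group scheme. -/
def gmTimes {n : Type} (H : Subgroup (n → ℂˣ)) : GroupFunctor where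
  obj T := GrpCat.of ((fns T.unop)ˣ × constPts H T.unop)
  map f := GrpCat.ofHom
    { toFun := fun z => (Units.map (pull f.unop).toMonoidHom z.1,
        ⟨fun i => Units.map (pull f.unop).toMonoidHom (z.2.1 i), constPts_pull H f.unop z.2.2⟩)
      map_one' := by
        ext
        · simp
        · simp
      map_mul' := fun s t => by
        ext
        · simp
        · simp }
  map_id T := by
    ext z
    · simp [pull_id]
    · simp [pull_id]
  map_comp f g := by
    ext z
    · simp [pull_comp]
    · simp [pull_comp]

/-- `(c, h) ∈ 𝔾_m × H` acts on `𝔸^n` by `x_i ↦ c h_i x_i`. -/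
def gmTimesWeights {n : Type} (H : Subgroup (n → ℂˣ)) : gmTimes H ⟶ torus n where
  app T := GrpCat.ofHom
    { toFun := fun z i => z.1 * z.2.1 i
      map_one' := by
        funext i
        simp
      map_mul' := fun s t => by
        funext i
        simp [mul_mul_mul_comm] }
  naturality T T' f := by
    refine GrpCat.hom_ext (MonoidHom.ext fun z => ?_)
    funext i
    exact (map_mul (Units.map (pull f.unop).toMonoidHom) z.1 (z.2.1 i)).symm

/-- The index sets `{i}`: `coordOpen puncturedSets` is `𝔸^n ∖ {0} = ⋃_i {x_i ≠ 0}`. -/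
def puncturedSets (n : Type) : Set (Finset n) := Set.range fun i => {i}

/-- The Libgober–Teitelbaum stack `[(ℂ^6 ∖ 0)/(ℂˣ × G_81)]`. -/
def ltStack (ζ₃ ζ₉ : ℂˣ) : BasedCategory SchC :=
  quotStack (gmTimes (G81 ζ₃ ζ₉)) (coordOpenPts (puncturedSets (Fin 6)))
    (scaleAction (gmTimesWeights (G81 ζ₃ ζ₉)) (puncturedSets (Fin 6)))

end

/-! The six vectors sum to zero, and up to scale this is their only linear relation. Hence a
nonnegative combination in which some generator is missing has uniquely determined coefficients
(`coeff_unique`). Cones on proper subsets of the generators therefore behave like those subsets: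
inclusion, faces and intersections of cones are inclusion, subsets and intersections of index sets.
This gives the fan, its maximal cones and its rays. Every such cone omits some generator, and each
generator is omitted by one that contains the other five, so the Cox open set is the punctured
affine space.

For an abelian group `A`, a homomorphism from the cokernel to `A` is a tuple satisfying five
monomial equations (`ltCoxEquiv`). The diagonal satisfies them, and the character `t 2 ^ 5 * (t 5 ^
4)⁻¹` has weight one on it, so it splits the diagonal off (`ltSplit`). In its kernel `ltTorsion A`
every coordinate is a ninth root of unity; over `ℂ` the kernel is exactly `G81`
(`G81_eq_ltTorsion`), and exponents modulo nine give its structure (`ltTorsionEquiv`).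

Leaving `A` arbitrary allows the same splitting to be applied to the units of `𝒪(T)`. What remains
for group schemes is that a function on a complex scheme with `x ^ 9 = 1` is locally constant, which
makes the kernel a constant group scheme (`constPts_ltTorsion`). The resulting isomorphism matches
groups, spaces and actions at once, and such an isomorphism of pairs induces an equivalence of
quotient stacks (`GIso.isStackIso`). -/

/-! ### Cones on proper subsets of vectors with only constant relations -/

section SimplicialFans

variable {d : ℕ} {J : Type} {u : J → Fin d → ℤ}

lemma realVec_mem_latticeCone {I : Set J} {i : J} (hi : i ∈ I) :
    realVec (u i) ∈ latticeCone u I :=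
  Submodule.subset_span ⟨i, hi, rfl⟩

lemma latticeCone_mono {I K : Set J} (h : I ⊆ K) : latticeCone u I ≤ latticeCone u K :=
  Submodule.span_mono (Set.image_mono h)

variable [Fintype J]

lemma mem_latticeCone_iff {I : Set J} {x : Fin d → ℝ} :
    x ∈ latticeCone u I ↔ ∃ a : J → ℝ, (∀ i, 0 ≤ a i) ∧ (∀ i, i ∉ I → a i = 0) ∧
      x = ∑ i, a i • realVec (u i) := by
  classical
  constructor
  · intro hx
    induction hx using Submodule.span_induction with
    | mem x hx =>
      obtain ⟨i, hi, rfl⟩ := hx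
      refine ⟨Pi.single i 1, fun j => ?_, fun j hj => ?_, ?_⟩
      · by_cases h : j = i
        · subst h; simp
        · simp [h]
      · have h : j ≠ i := fun h => hj (h ▸ hi)
        simp [h]
      · simp [Pi.single_apply]
    | zero => exact ⟨0, by simp, by simp, by simp⟩
    | add x y _ _ hx hy =>
      obtain ⟨a, ha, ha', rfl⟩ := hx
      obtain ⟨b, hb, hb', rfl⟩ := hy
      refine ⟨a + b, fun i => add_nonneg (ha i) (hb i), fun i hi => ?_, ?_⟩
      · simp [ha' i hi, hb' i hi]
      · simp [add_smul, Finset.sum_add_distrib]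
    | smul c x _ hx =>
      obtain ⟨a, ha, ha', rfl⟩ := hx
      refine ⟨fun i => (c : ℝ) * a i, fun i => mul_nonneg c.2 (ha i), fun i hi => ?_, ?_⟩
      · simp [ha' i hi]
      · simp only [Finset.smul_sum, mul_smul]
        rfl
  · rintro ⟨a, ha, ha', rfl⟩
    refine Submodule.sum_mem _ fun i _ => ?_
    by_cases hi : i ∈ I
    · exact PointedCone.smul_mem _ (ha i) (Submodule.subset_span ⟨i, hi, rfl⟩)
    · simp [ha' i hi]

/-- If a nonnegative combination lies in a face, so does each of its terms; dividing by a nonzero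
coefficient puts the generator itself in the face. No condition on the relations is needed. -/
lemma PointedCone.IsFaceOf.eq_latticeCone {K : Set J} {τ : PointedCone ℝ (Fin d → ℝ)}
    (h : τ.IsFaceOf (latticeCone u K)) :
    τ = latticeCone u {i | i ∈ K ∧ realVec (u i) ∈ τ} := by
  refine le_antisymm (fun x hx => ?_) (Submodule.span_le.2 ?_)
  · obtain ⟨a, ha, ha', rfl⟩ := mem_latticeCone_iff.1 (h.le hx)
    refine mem_latticeCone_iff.2 ⟨a, ha, fun i hi => ?_, rfl⟩
    by_contra hne
    have hiK : i ∈ K := by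
      by_contra hiK
      exact hne (ha' i hiK)
    refine hi ⟨hiK, ?_⟩
    have hx' : ∑ i, a i • realVec (u i) ∈ τ := hx
    have hmem : ∀ j, a j • realVec (u j) ∈ latticeCone u K := fun j => by
      by_cases hj : j ∈ K
      · exact PointedCone.smul_mem _ (ha j) (realVec_mem_latticeCone hj)
      · simp [ha' j hj]
    have h₁ := h.mem_of_sum_mem hmem hx' i
    have h₂ := PointedCone.smul_mem τ (inv_nonneg.2 (ha i)) h₁
    rwa [smul_smul, inv_mul_cancel₀ hne, one_smul] at h₂
  · rintro _ ⟨i, hi, rfl⟩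
    exact hi.2

/-- Every real linear relation between the vectors `u i` has equal coefficients. -/
def HasOnlyConstantRelations (u : J → Fin d → ℤ) : Prop :=
  ∀ a : J → ℝ, ∑ i, a i • realVec (u i) = 0 → ∀ i j, a i = a j

namespace HasOnlyConstantRelations

variable (hu : HasOnlyConstantRelations u)
include hu

lemma eq_zero {a : J → ℝ} {j : J} (hj : a j = 0) (h : ∑ i, a i • realVec (u i) = 0) : a = 0 :=
  funext fun i => (hu a h i j).trans hj

/-- The difference `a - b` is constant. It is at most zero where `a` vanishes and at least zero
where `b` vanishes, so the constant is zero. -/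
lemma coeff_unique {a b : J → ℝ} (ha : ∀ i, 0 ≤ a i) (hb : ∀ i, 0 ≤ b i) {i j : J}
    (hi : a i = 0) (hj : b j = 0)
    (h : ∑ k, a k • realVec (u k) = ∑ k, b k • realVec (u k)) : a = b := by
  have key : ∀ k l, a k - b k = a l - b l := hu (fun k => a k - b k) (by
    simp only [sub_smul, Finset.sum_sub_distrib, h, sub_self])
  funext k
  have h₁ := key k i
  have h₂ := key k j
  linarith [ha j, hb i]

lemma realVec_mem_iff {I : Set J} (hI : I ≠ Set.univ) [Nontrivial J] {i : J} :
    realVec (u i) ∈ latticeCone u I ↔ i ∈ I := by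
  classical
  refine ⟨fun h => ?_, realVec_mem_latticeCone⟩
  obtain ⟨a, ha, ha', h⟩ := mem_latticeCone_iff.1 h
  obtain ⟨j, hj⟩ := (Set.ne_univ_iff_exists_notMem I).1 hI
  -- `Pi.single i 1` must also vanish somewhere for `coeff_unique` to apply, hence the second index.
  obtain ⟨k, hk⟩ := exists_ne i
  have e : Pi.single i 1 = a := by
    refine hu.coeff_unique (i := k) (j := j) (fun l => ?_) ha (by simp [hk]) (ha' j hj) ?_
    · by_cases h : l = i
      · subst h; simp
      · simp [h]
    · rw [← h]; simp [Pi.single_apply]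
  by_contra hi
  have := ha' i hi
  simp [← e] at this

lemma latticeCone_le_iff [Nontrivial J] {I K : Set J} (hK : K ≠ Set.univ) :
    latticeCone u I ≤ latticeCone u K ↔ I ⊆ K :=
  ⟨fun h _ hi => (hu.realVec_mem_iff hK).1 (h (realVec_mem_latticeCone hi)), latticeCone_mono⟩

lemma latticeCone_inj [Nontrivial J] {I K : Set J} (hI : I ≠ Set.univ) (hK : K ≠ Set.univ) :
    latticeCone u I = latticeCone u K ↔ I = K := by
  rw [le_antisymm_iff, hu.latticeCone_le_iff hK, hu.latticeCone_le_iff hI, Set.Subset.antisymm_iff]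

/-- By uniqueness, the coefficients of `c • x + y` are those of `x` and `y` combined. Being
nonnegative, they can vanish outside `I` only if those of `x` do. -/
lemma isFaceOf_of_subset {I K : Set J} (hIK : I ⊆ K) (hK : K ≠ Set.univ) :
    (latticeCone u I).IsFaceOf (latticeCone u K) := by
  obtain ⟨j, hj⟩ := (Set.ne_univ_iff_exists_notMem K).1 hK
  refine ⟨latticeCone_mono hIK, fun {x y c} hx hy hc h => ?_⟩
  obtain ⟨a, ha, ha', rfl⟩ := mem_latticeCone_iff.1 hx
  obtain ⟨b, hb, hb', rfl⟩ := mem_latticeCone_iff.1 hy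
  obtain ⟨s, hs, hs', h⟩ := mem_latticeCone_iff.1 h
  have e : (fun i => c * a i + b i) = s := by
    refine hu.coeff_unique (i := j) (j := j)
      (fun i => add_nonneg (mul_nonneg hc.le (ha i)) (hb i)) hs ?_ (hs' j fun h => hj (hIK h)) ?_
    · simp [ha' j hj, hb' j hj]
    · rw [← h]
      simp [add_smul, Finset.sum_add_distrib, Finset.smul_sum, mul_smul]
  refine mem_latticeCone_iff.2 ⟨a, ha, fun i hi => ?_, rfl⟩
  have h₁ : c * a i + b i = 0 := (congrFun e i).trans (hs' i hi)
  have h₂ : c * a i = 0 := by linarith [hb i, mul_nonneg hc.le (ha i)]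
  exact (mul_eq_zero.1 h₂).resolve_left hc.ne'

lemma isFaceOf_iff [Nontrivial J] {I K : Set J} (hK : K ≠ Set.univ) :
    (latticeCone u I).IsFaceOf (latticeCone u K) ↔ I ⊆ K :=
  ⟨fun h => (hu.latticeCone_le_iff hK).1 h.le, fun h => hu.isFaceOf_of_subset h hK⟩

lemma inf_latticeCone {I K : Set J} (hI : I ≠ Set.univ) (hK : K ≠ Set.univ) :
    latticeCone u I ⊓ latticeCone u K = latticeCone u (I ∩ K) := by
  refine le_antisymm ?_ (le_inf (latticeCone_mono Set.inter_subset_left)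
    (latticeCone_mono Set.inter_subset_right))
  rintro x ⟨hx, hy⟩
  obtain ⟨i, hi⟩ := (Set.ne_univ_iff_exists_notMem I).1 hI
  obtain ⟨j, hj⟩ := (Set.ne_univ_iff_exists_notMem K).1 hK
  obtain ⟨a, ha, ha', rfl⟩ := mem_latticeCone_iff.1 hx
  obtain ⟨b, hb, hb', h⟩ := mem_latticeCone_iff.1 hy
  have e := hu.coeff_unique ha hb (ha' i hi) (hb' j hj) h
  refine mem_latticeCone_iff.2 ⟨a, ha, fun k hk => ?_, rfl⟩
  by_cases hkI : k ∈ I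
  · rw [e]
    exact hb' k fun hkK => hk ⟨hkI, hkK⟩
  · exact ha' k hkI

lemma salient_latticeCone {I : Set J} (hI : I ≠ Set.univ) :
    (latticeCone u I : ConvexCone ℝ (Fin d → ℝ)).Salient := by
  intro x hx hx0 hnx
  obtain ⟨i, hi⟩ := (Set.ne_univ_iff_exists_notMem I).1 hI
  obtain ⟨a, ha, ha', rfl⟩ := mem_latticeCone_iff.1 hx
  obtain ⟨b, hb, hb', h⟩ := mem_latticeCone_iff.1 hnx
  -- Adding the expressions of `x` and `-x` gives a relation vanishing at `i`, hence everywhere;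
  -- nonnegativity then kills both summands.
  have e := hu.eq_zero (a := a + b) (j := i) (by simp [ha' i hi, hb' i hi]) (by
    simp [add_smul, Finset.sum_add_distrib, ← h])
  refine hx0 (Finset.sum_eq_zero fun k _ => ?_)
  have h₁ : a k + b k = 0 := congrFun e k
  have h₂ : a k = 0 := by linarith [ha k, hb k]
  simp [h₂]

lemma linearIndependent {I : Set J} (hI : I ≠ Set.univ) :
    LinearIndependent ℝ fun i : I => realVec (u i) := by
  classical
  obtain ⟨j, hj⟩ := (Set.ne_univ_iff_exists_notMem I).1 hI
  rw [Fintype.linearIndependent_iff]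
  intro g hg i
  have e := hu.eq_zero (a := fun k => if h : k ∈ I then g ⟨k, h⟩ else 0) (j := j)
    (by simp [hj]) (by
      rw [← hg, ← Finset.sum_subset (Finset.subset_univ I.toFinset)]
      · rw [Finset.sum_subtype (p := (· ∈ I)) _ (by simp)]
        exact Finset.sum_congr rfl fun k _ => by simp
      · intro k _ hk
        have hk : k ∉ I := by simpa using hk
        simp [hk])
  have := congrFun e i
  simpa using this

lemma finrank_span_latticeCone {I : Set J} (hI : I ≠ Set.univ) :
    Module.finrank ℝ (Submodule.span ℝ (latticeCone u I : Set (Fin d → ℝ))) = I.ncard := by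
  classical
  have e : Submodule.span ℝ (latticeCone u I : Set (Fin d → ℝ)) =
      Submodule.span ℝ (Set.range fun i : I => realVec (u i)) := by
    have h : Set.range (fun i : I => realVec (u i)) = (fun i => realVec (u i)) '' I := by
      ext; simp
    rw [h]
    exact le_antisymm (Submodule.span_le.2 fun x hx => PointedCone.hull_le_span (R := ℝ) _ hx)
      (Submodule.span_mono PointedCone.subset_hull)
  rw [e, finrank_span_eq_card (hu.linearIndependent hI), ← Nat.card_eq_fintype_card]
  rfl

/-- The proper subsets of a family of vectors with only constant relations span the cones
of a fan. -/
lemma isFan : IsFan {τ | ∃ I : Set J, I ≠ Set.univ ∧ τ = latticeCone u I} where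
  finite := ((Set.toFinite (Set.univ : Set (Set J))).image (latticeCone u)).subset (by
    rintro _ ⟨I, -, rfl⟩
    exact ⟨I, trivial, rfl⟩)
  rational := by
    rintro _ ⟨I, -, rfl⟩
    refine ⟨u '' I, (Set.toFinite I).image u, ?_⟩
    rw [latticeCone, latticeCone, Set.image_image]
    rfl
  strongly_convex := by
    rintro _ ⟨I, hI, rfl⟩
    exact hu.salient_latticeCone hI
  face_mem := by
    rintro _ ⟨I, hI, rfl⟩ τ hτ
    refine ⟨_, fun h => hI ?_, hτ.eq_latticeCone⟩
    exact Set.eq_univ_of_univ_subset (h ▸ fun _ hi => hi.1)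
  inter_face := by
    rintro _ ⟨I, hI, rfl⟩ _ ⟨K, hK, rfl⟩
    rw [hu.inf_latticeCone hI hK]
    exact ⟨hu.isFaceOf_of_subset Set.inter_subset_left hI,
      hu.isFaceOf_of_subset Set.inter_subset_right hK⟩

end HasOnlyConstantRelations

end SimplicialFans

/-! ### Uniqueness of primitive generators -/

/-- Two generators of a ray are nonnegative real multiples of each other. Comparing one nonzero
coordinate turns this into `q • u = p • v` with `p`, `q` coprime. Then `p` divides `u` and `q`
divides `v`, so primitivity makes both units. -/
lemma IsPrimGen.unique {d : ℕ} {ρ : PointedCone ℝ (Fin d → ℝ)} {u v : Fin d → ℤ}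
    (hu : IsPrimGen ρ u) (hv : IsPrimGen ρ v) : u = v := by
  have key : ∀ {u v : Fin d → ℤ}, IsPrimGen ρ u → IsPrimGen ρ v →
      ∃ c : ℝ, 0 ≤ c ∧ realVec u = c • realVec v := fun {u v} hu hv => by
    have h : realVec u ∈ PointedCone.hull ℝ {realVec v} := by
      rw [← hv.1, hu.1]
      exact PointedCone.subset_hull rfl
    obtain ⟨c, hc⟩ := Submodule.mem_span_singleton.1 h
    exact ⟨c, c.2, hc.symm⟩
  obtain ⟨a, ha, huv⟩ := key hu hv
  have hu0 : u ≠ 0 := fun h => not_isUnit_zero (hu.2 0 u (by simp [h]))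
  obtain ⟨i, hi⟩ := Function.ne_iff.1 hu0
  have hi' : (u i : ℝ) = a * v i := congrFun huv i
  have hui : (u i : ℝ) ≠ 0 := by exact_mod_cast hi
  have hvi : v i ≠ 0 := fun h => hui (by rw [hi', h]; simp)
  obtain ⟨g, p, q, hg, hpq, hp, hq⟩ := Int.exists_gcd_one' (m := u i) (n := v i)
    (Int.gcd_pos_of_ne_zero_left _ hi)
  have hq0 : q ≠ 0 := by
    rintro rfl
    simp at hq
    exact hvi hq
  have hlin : ∀ j, q * u j = p * v j := by
    intro j
    have hj' : (u j : ℝ) = a * v j := congrFun huv j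
    have : v i * u j = u i * v j := by
      have : (v i * u j : ℝ) = u i * v j := by rw [hi', hj']; ring
      exact_mod_cast this
    rw [hp, hq] at this
    have hg' : (g : ℤ) ≠ 0 := by exact_mod_cast hg.ne'
    apply mul_left_cancel₀ hg'
    linear_combination this
  have hcop : IsCoprime p q := Int.isCoprime_iff_gcd_eq_one.2 hpq
  have hqv : ∀ j, q ∣ v j := fun j =>
    hcop.symm.dvd_of_dvd_mul_left (Dvd.intro _ (hlin j))
  have hpu : ∀ j, p ∣ u j := fun j =>
    hcop.dvd_of_dvd_mul_left (Dvd.intro _ (hlin j).symm)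
  choose v' hv' using hqv
  choose u' hu' using hpu
  have hqU := Int.isUnit_iff.1 (hv.2 q v' (funext hv'))
  have hpU := Int.isUnit_iff.1 (hu.2 p u' (funext hu'))
  have hpqr : (p : ℝ) = a * q := by
    have hg' : (g : ℝ) ≠ 0 := by exact_mod_cast hg.ne'
    have : (p * g : ℝ) = a * (q * g) := by
      rw [hp, hq] at hi'
      exact_mod_cast hi'
    apply mul_right_cancel₀ hg'
    rw [this]; ring
  -- Opposite signs are excluded because the ratio `a` is nonnegative.
  have hpq' : p = q := by
    rcases hqU with rfl | rfl <;> rcases hpU with rfl | rfl <;> first | rfl | skip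
    · norm_num at hpqr; linarith
    · norm_num at hpqr; linarith
  funext j
  have := hlin j
  rw [hpq'] at this
  exact mul_left_cancel₀ hq0 this

lemma IsPrimGen.primGen_eq {d : ℕ} {ρ : PointedCone ℝ (Fin d → ℝ)} {u : Fin d → ℤ}
    (hu : IsPrimGen ρ u) : primGen ρ = u :=
  (Classical.epsilon_spec (p := IsPrimGen ρ) ⟨u, hu⟩).unique hu

noncomputable section

/-! ### The Libgober–Teitelbaum fan, its rays and its Cox open set -/

lemma ltVec_hasOnlyConstantRelations : HasOnlyConstantRelations ltVec := by
  intro a ha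
  have h := fun k => congrFun ha k
  have h0 := h 0
  have h1 := h 1
  have h2 := h 2
  have h3 := h 3
  have h4 := h 4
  simp only [Fin.sum_univ_six, Pi.add_apply, Pi.smul_apply, realVec, ltVec, smul_eq_mul,
    Pi.zero_apply] at h0 h1 h2 h3 h4
  simp at h0 h1 h2 h3 h4
  have key : ∀ i, a i = a 5 := by
    intro i
    fin_cases i <;> simp <;> linarith
  intro i j
  rw [key i, key j]

/-- Faces of a cone on five generators are spanned by the generators they contain, and every proper
subset misses some `j` and so lies in the complement of `j`. -/
lemma mem_ltFan_iff {τ : PointedCone ℝ (Fin 5 → ℝ)} :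
    τ ∈ ltFan ↔ ∃ I : Set (Fin 6), I ≠ Set.univ ∧ τ = latticeCone ltVec I := by
  constructor
  · rintro ⟨I, hI, hτ⟩
    refine ⟨_, fun h => ?_, hτ.eq_latticeCone⟩
    have : I = Finset.univ := Finset.eq_univ_of_forall fun i =>
      ((Set.eq_univ_iff_forall.1 h) i).1
    rw [this] at hI
    simp at hI
  · rintro ⟨I, hI, rfl⟩
    obtain ⟨j, hj⟩ := (Set.ne_univ_iff_exists_notMem I).1 hI
    refine ⟨Finset.univ.erase j, by simp, ltVec_hasOnlyConstantRelations.isFaceOf_of_subset ?_ ?_⟩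
    · intro i hi
      have : i ≠ j := fun h => hj (h ▸ hi)
      simpa using this
    · exact (Set.ne_univ_iff_exists_notMem _).2 ⟨j, by simp⟩

lemma isFan_ltFan : IsFan ltFan := by
  have h : ltFan = {τ | ∃ I : Set (Fin 6), I ≠ Set.univ ∧ τ = latticeCone ltVec I} :=
    Set.ext fun _ => mem_ltFan_iff
  rw [h]
  exact ltVec_hasOnlyConstantRelations.isFan

lemma coe_finset_ne_univ_of_card {I : Finset (Fin 6)} (hI : I.card = 5) :
    (I : Set (Fin 6)) ≠ Set.univ := by
  intro h
  rw [Finset.coe_eq_univ] at h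
  rw [h] at hI
  simp at hI

lemma maximal_mem_ltFan_iff {σ : PointedCone ℝ (Fin 5 → ℝ)} :
    Maximal (· ∈ ltFan) σ ↔ ∃ I : Finset (Fin 6), I.card = 5 ∧ σ = latticeCone ltVec I := by
  constructor
  · rintro ⟨⟨I, hI, hσ⟩, hmax⟩
    exact ⟨I, hI, le_antisymm hσ.le (hmax ⟨I, hI, .refl _⟩ hσ.le)⟩
  · rintro ⟨I, hI, rfl⟩
    refine ⟨⟨I, hI, .refl _⟩, ?_⟩
    rintro τ ⟨K, hK, hτ⟩ hle
    have hIK : I ⊆ K := by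
      have := (ltVec_hasOnlyConstantRelations.latticeCone_le_iff
        (coe_finset_ne_univ_of_card hK)).1 (hle.trans hτ.le)
      exact_mod_cast this
    have : I = K := Finset.eq_of_subset_of_card_le hIK (by omega)
    rw [this]
    exact hτ.le

lemma singleton_ne_univ_fin_six (i : Fin 6) : ({i} : Set (Fin 6)) ≠ Set.univ := by
  obtain ⟨j, hj⟩ := exists_ne i
  exact (Set.ne_univ_iff_exists_notMem _).2 ⟨j, hj⟩

lemma latticeCone_mem_rays_ltFan (i : Fin 6) : latticeCone ltVec {i} ∈ rays ltFan :=
  ⟨mem_ltFan_iff.2 ⟨{i}, singleton_ne_univ_fin_six i, rfl⟩, by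
    rw [ltVec_hasOnlyConstantRelations.finrank_span_latticeCone (singleton_ne_univ_fin_six i)]
    simp⟩

/-- The rays `ρ_i = Cone(u_i)` of the Libgober–Teitelbaum fan. -/
def ltRay : Fin 6 ≃ rays ltFan :=
  Equiv.ofBijective (fun i => ⟨latticeCone ltVec {i}, latticeCone_mem_rays_ltFan i⟩) <| by
    constructor
    · intro i j h
      have h := congrArg Subtype.val h
      exact Set.singleton_injective ((ltVec_hasOnlyConstantRelations.latticeCone_inj
        (singleton_ne_univ_fin_six i) (singleton_ne_univ_fin_six j)).1 h)
    · rintro ⟨τ, hτ, h⟩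
      obtain ⟨I, hI, rfl⟩ := mem_ltFan_iff.1 hτ
      rw [ltVec_hasOnlyConstantRelations.finrank_span_latticeCone hI, Set.ncard_eq_one] at h
      obtain ⟨i, rfl⟩ := h
      exact ⟨i, rfl⟩

lemma ltRay_coe (i : Fin 6) : (ltRay i).1 = latticeCone ltVec {i} := rfl

lemma exists_ltVec_eq_neg_one (i : Fin 6) : ∃ k, ltVec i k = -1 := by
  revert i; decide

lemma isPrimGen_ltRay (i : Fin 6) : IsPrimGen (ltRay i).1 (ltVec i) := by
  refine ⟨by rw [ltRay_coe, latticeCone, Set.image_singleton], fun k v h => ?_⟩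
  obtain ⟨j, hj⟩ := exists_ltVec_eq_neg_one i
  have h' : k * v j = -1 := by rw [← hj, h]; rfl
  exact IsUnit.of_mul_eq_one (-v j) (by rw [mul_neg, h', neg_neg])

lemma primGen_ltRay (i : Fin 6) : primGen (ltRay i).1 = ltVec i :=
  (isPrimGen_ltRay i).primGen_eq

/-- Each cone omits some ray `j`, so its monomial is divisible by the coordinate of `j`. Conversely,
the cone on all generators but `i` has exactly the coordinate of `i` as its monomial. -/
lemma preimage_coordOpen_coxSets_ltFan (T : SchC) (x : rays ltFan → fns T) :
    toAffine T x ⁻¹ᵁ coordOpen (coxSets ltFan) =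
      toAffine T (fun i => x (ltRay i)) ⁻¹ᵁ coordOpen (puncturedSets (Fin 6)) := by
  classical
  rw [preimage_coordOpen, preimage_coordOpen]
  refine le_antisymm (iSup₂_le ?_) (iSup₂_le ?_)
  · rintro s ⟨σ, hσ, hs⟩
    obtain ⟨I, hI, rfl⟩ := mem_ltFan_iff.1 hσ
    obtain ⟨j, hj⟩ := (Set.ne_univ_iff_exists_notMem I).1 hI
    have hjs : ltRay j ∈ s := by
      rw [hs, ltRay_coe, ltVec_hasOnlyConstantRelations.isFaceOf_iff hI]
      simpa using hj
    refine le_trans ?_ (le_iSup₂_of_le {j} ⟨j, rfl⟩ le_rfl)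
    rw [← Finset.mul_prod_erase s _ hjs, Scheme.basicOpen_mul, Finset.prod_singleton]
    exact inf_le_left
  · rintro _ ⟨i, rfl⟩
    refine le_iSup₂_of_le {ltRay i} ⟨latticeCone ltVec {i}ᶜ, ?_, ?_⟩ (by simp)
    · exact mem_ltFan_iff.2 ⟨_, (Set.ne_univ_iff_exists_notMem _).2 ⟨i, by simp⟩, rfl⟩
    · intro ρ
      obtain ⟨j, rfl⟩ := ltRay.surjective ρ
      rw [ltRay_coe, ltVec_hasOnlyConstantRelations.isFaceOf_iff
        ((Set.ne_univ_iff_exists_notMem _).2 ⟨i, by simp⟩)]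
      simp [eq_comm]

/-! ### Coordinates on the Cox group of a fan -/

section CoxGroups

variable {d : ℕ} (F : Set (PointedCone ℝ (Fin d → ℝ))) {A : Type} [CommGroup A]

lemma coxCoord_injective [Finite (rays F)] : Function.Injective (coxCoord F A) := by
  classical
  have := Fintype.ofFinite (rays F)
  intro g h e
  have key : g.toAdditiveRight.comp (QuotientAddGroup.mk' (divMap F).range) =
      h.toAdditiveRight.comp (QuotientAddGroup.mk' (divMap F).range) := by
    refine AddMonoidHom.functions_ext _ _ _ fun ρ n => ?_
    have hn : (Pi.single ρ n : rays F → ℤ) = n • Pi.single ρ 1 := by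
      rw [← Pi.single_smul]; simp
    rw [hn, map_zsmul, map_zsmul]
    congr 1
    convert congrArg Additive.ofMul (congrFun e ρ) using 1 <;>
    · simp only [coxCoord, divClass]
      rfl
  refine MonoidHom.ext fun c => ?_
  induction c using Multiplicative.rec with | _ c
  obtain ⟨v, rfl⟩ := QuotientAddGroup.mk_surjective c
  exact congrArg Additive.toMul (DFunLike.congr_fun key v)

/-- The divisor of a character is zero in the cokernel; expanding it in the classes of the `D_ρ` and
applying `g` gives the product. `exists_coxCoord_eq` is the converse. -/
lemma coxCoord_prod_zpow_divMap [Fintype (rays F)] (g : CoxGroup F A) (m : Fin d → ℤ) :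
    ∏ ρ, coxCoord F A g ρ ^ divMap F m ρ = 1 := by
  classical
  have h : ∑ ρ, divMap F m ρ • divClass F ρ = 0 := by
    have h₁ : (QuotientAddGroup.mk' (divMap F).range) (divMap F m) = 0 :=
      (QuotientAddGroup.eq_zero_iff _).2 ⟨m, rfl⟩
    rw [← h₁, ← Finset.univ_sum_single (divMap F m), map_sum]
    refine Finset.sum_congr rfl fun ρ _ => ?_
    have hn : (Pi.single ρ (divMap F m ρ) : rays F → ℤ) = divMap F m ρ • Pi.single ρ 1 := by
      rw [← Pi.single_smul]; simp
    rw [Finset.univ_sum_single, hn, map_zsmul]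
    rfl
  have h₂ := congrArg (fun c => g (Multiplicative.ofAdd c)) h
  simp only [ofAdd_sum, map_prod, ofAdd_zsmul, map_zpow, ofAdd_zero, map_one] at h₂
  exact h₂

lemma exists_coxCoord_eq [Fintype (rays F)] (t : rays F → A)
    (ht : ∀ m, ∏ ρ, t ρ ^ divMap F m ρ = 1) : ∃ g : CoxGroup F A, coxCoord F A g = t := by
  classical
  let L : (rays F → ℤ) →+ Additive A :=
    { toFun := fun v => Additive.ofMul (∏ ρ, t ρ ^ v ρ)
      map_zero' := by simp
      map_add' := fun v w => by
        simp [zpow_add, Finset.prod_mul_distrib] }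
  have hL : (divMap F).range ≤ L.ker := by
    rintro _ ⟨m, rfl⟩
    exact congrArg Additive.ofMul (ht m)
  refine ⟨AddMonoidHom.toMultiplicativeLeft (QuotientAddGroup.lift _ L hL), funext fun ρ => ?_⟩
  change ∏ ρ', t ρ' ^ (Pi.single ρ 1 : rays F → ℤ) ρ' = t ρ
  rw [Finset.prod_eq_single ρ]
  · simp
  · intro ρ' _ h
    simp [h]
  · simp

end CoxGroups

/-! ### The Cox group of the fan and its splitting, over any abelian group -/

/-- The tuples `t` with `∏ i, t_i ^ ⟨m, u_i⟩ = 1` for all `m`. -/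
def ltRel (A : Type) [CommGroup A] : Subgroup (Fin 6 → A) where
  carrier := {t | ∀ k, ∏ i, t i ^ ltVec i k = 1}
  one_mem' := by simp
  mul_mem' {s t} hs ht k := by
    simp only [Pi.mul_apply, mul_zpow, Finset.prod_mul_distrib, hs k, ht k, one_mul]
  inv_mem' {s} hs k := by
    simp only [Pi.inv_apply, inv_zpow, Finset.prod_inv_distrib, hs k, inv_one]

lemma mem_ltRel_iff {A : Type} [CommGroup A] {t : Fin 6 → A} :
    t ∈ ltRel A ↔ t 0 ^ 3 = t 3 * t 4 * t 5 ∧ t 1 ^ 3 = t 3 * t 4 * t 5 ∧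
      t 2 ^ 3 = t 3 * t 4 * t 5 ∧ t 3 ^ 3 = t 0 * t 1 * t 2 ∧ t 4 ^ 3 = t 0 * t 1 * t 2 := by
  have h : t ∈ ltRel A ↔ ∀ k, ∏ i, t i ^ ltVec i k = 1 := Iff.rfl
  have h₁ : ∀ a x y z : A, a * x⁻¹ * y⁻¹ * z⁻¹ = 1 ↔ a = x * y * z := fun a x y z => by
    rw [mul_assoc, mul_assoc, ← mul_inv, ← mul_inv, mul_inv_eq_one, mul_assoc]
  have h₂ : ∀ a x y z : A, x⁻¹ * y⁻¹ * z⁻¹ * a = 1 ↔ a = x * y * z := fun a x y z => by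
    rw [← mul_inv, ← mul_inv, inv_mul_eq_one, eq_comm]
  rw [h]
  simp only [Fin.forall_fin_succ, Fin.prod_univ_six, ltVec, IsEmpty.forall_iff, and_true]
  simp [zpow_ofNat, h₁, h₂]

/-- The complement in `ltRel A` of the diagonal copy of `A`. -/
def ltTorsion (A : Type) [CommGroup A] : Subgroup (Fin 6 → A) where
  -- The exponents 5 and 4 differ by one, so the character has weight one on the diagonal; it is
  -- trivial on `G81`, where `t 2` and `t 5` are mutually inverse ninth roots of unity.
  carrier := {t | t ∈ ltRel A ∧ t 2 ^ 5 = t 5 ^ 4}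
  one_mem' := ⟨one_mem _, by simp⟩
  mul_mem' {s t} hs ht := ⟨mul_mem hs.1 ht.1, by simp [mul_pow, hs.2, ht.2]⟩
  inv_mem' {s} hs := ⟨inv_mem hs.1, by simp [hs.2]⟩

section LTTorsion

variable {A : Type} [CommGroup A]

instance : Fintype (rays ltFan) := Fintype.ofEquiv _ ltRay

lemma divMap_ltFan (m : Fin 5 → ℤ) (i : Fin 6) :
    divMap ltFan m (ltRay i) = ∑ k, m k * ltVec i k := by
  rw [← primGen_ltRay]
  rfl

lemma prod_zpow_divMap_ltFan (t : rays ltFan → A) (m : Fin 5 → ℤ) :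
    ∏ ρ, t ρ ^ divMap ltFan m ρ = ∏ k, (∏ i, t (ltRay i) ^ ltVec i k) ^ m k := by
  rw [← ltRay.prod_comp]
  simp only [divMap_ltFan, ← Finset.prod_zpow, ← zpow_mul]
  rw [Finset.prod_comm]
  refine Finset.prod_congr rfl fun i _ => ?_
  simp only [Fin.sum_univ_five, Fin.prod_univ_five, zpow_add, mul_comm (m _)]

lemma coxCoord_ltRay_mem_ltRel (g : CoxGroup ltFan A) :
    (fun i => coxCoord ltFan A g (ltRay i)) ∈ ltRel A := by
  intro k
  have h := coxCoord_prod_zpow_divMap ltFan g (Pi.single k 1)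
  rw [prod_zpow_divMap_ltFan, Finset.prod_eq_single k] at h
  · simpa using h
  · intro l _ hl
    simp [hl]
  · simp

/-- The coordinates of an element of the Cox group of the Libgober–Teitelbaum fan. -/
def ltCoxCoord (A : Type) [CommGroup A] : CoxGroup ltFan A →* ltRel A where
  toFun g := ⟨fun i => coxCoord ltFan A g (ltRay i), coxCoord_ltRay_mem_ltRel g⟩
  map_one' := by
    ext i
    simp
  map_mul' g h := by
    ext i
    simp

lemma ltCoxCoord_bijective : Function.Bijective (ltCoxCoord A) := by
  constructor
  · intro g h e
    refine coxCoord_injective ltFan (funext fun ρ => ?_)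
    obtain ⟨i, rfl⟩ := ltRay.surjective ρ
    exact congrFun (congrArg Subtype.val e) i
  · rintro ⟨t, ht⟩
    obtain ⟨g, hg⟩ := exists_coxCoord_eq ltFan (fun ρ => t (ltRay.symm ρ)) fun m => by
      rw [prod_zpow_divMap_ltFan]
      simp only [Equiv.symm_apply_apply]
      exact Finset.prod_eq_one fun k _ => by rw [ht k, one_zpow]
    refine ⟨g, Subtype.ext (funext fun i => ?_)⟩
    change coxCoord ltFan A g (ltRay i) = t i
    rw [hg]
    exact congrArg t (ltRay.symm_apply_apply i)

/-- The Cox group of the Libgober–Teitelbaum fan in coordinates. -/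
def ltCoxEquiv (A : Type) [CommGroup A] : CoxGroup ltFan A ≃* ltRel A :=
  MulEquiv.ofBijective (ltCoxCoord A) ltCoxCoord_bijective

lemma coxCoord_ltCoxEquiv_symm (t : ltRel A) (i : Fin 6) :
    coxCoord ltFan A ((ltCoxEquiv A).symm t) (ltRay i) = t.1 i := by
  have h : ltCoxCoord A ((ltCoxEquiv A).symm t) = t := (ltCoxEquiv A).apply_symm_apply t
  exact congrFun (congrArg Subtype.val h) i

lemma const_mem_ltRel (c : A) : (fun _ => c) ∈ ltRel A := by
  rw [mem_ltRel_iff]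
  simp [pow_succ]

/-- The product of the five relations gives the sixth, `t 5 ^ 3 = t 0 * t 1 * t 2`. The first three
then give `t 5 ^ 9 = t 2 ^ 9`, and combining this with `t 2 ^ 5 = t 5 ^ 4` yields both `t 2 ^ 9 = 1`
and `t 5 = (t 2)⁻¹`. -/
lemma pow_nine_of_mem_ltTorsion {t : Fin 6 → A} (ht : t ∈ ltTorsion A) : t 2 ^ 9 = 1 ∧
    t 5 = (t 2)⁻¹ ∧ t 5 ^ 3 = t 0 * t 1 * t 2 := by
  obtain ⟨h, h₅⟩ := ht
  obtain ⟨h₀, h₁, h₂, h₃, h₄⟩ := mem_ltRel_iff.1 h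
  -- In additive notation the monomial relations become linear over `ℤ`, and `module` can check
  -- their combinations.
  replace h₀ := congrArg Additive.ofMul h₀
  replace h₁ := congrArg Additive.ofMul h₁
  replace h₂ := congrArg Additive.ofMul h₂
  replace h₃ := congrArg Additive.ofMul h₃
  replace h₄ := congrArg Additive.ofMul h₄
  replace h₅ := congrArg Additive.ofMul h₅
  simp only [ofMul_mul, ofMul_pow] at h₀ h₁ h₂ h₃ h₄ h₅
  have e : 3 • Additive.ofMul (t 5) = Additive.ofMul (t 0) + Additive.ofMul (t 1) +
      Additive.ofMul (t 2) := by
    linear_combination (norm := module) (-1 : ℤ) • (h₀ + h₁ + h₂ + h₃ + h₄)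
  have e₂ : 9 • Additive.ofMul (t 2) = 0 := by
    linear_combination (norm := module) (9 : ℤ) • h₅ + (12 : ℤ) • e + (4 : ℤ) • (h₀ + h₁ + h₂) -
      (12 : ℤ) • h₂
  refine ⟨Additive.ofMul.injective e₂, Additive.ofMul.injective ?_, Additive.ofMul.injective e⟩
  rw [ofMul_inv]
  linear_combination (norm := module) (2 : ℤ) • h₅ + (3 : ℤ) • e + (h₀ + h₁ + h₂) - (3 : ℤ) • h₂

/-- Every coordinate has the same cube as `t 2` or `t 5`. -/
lemma pow_nine_eq_one_of_mem_ltTorsion {t : Fin 6 → A} (ht : t ∈ ltTorsion A) (i : Fin 6) :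
    t i ^ 9 = 1 := by
  obtain ⟨e₂, e₅, e⟩ := pow_nine_of_mem_ltTorsion ht
  obtain ⟨h₀, h₁, h₂, h₃, h₄⟩ := mem_ltRel_iff.1 ht.1
  have e₅' : t 5 ^ 9 = 1 := by rw [e₅, inv_pow, e₂, inv_one]
  have key : ∀ j k, t j ^ 3 = t k ^ 3 → t k ^ 9 = 1 → t j ^ 9 = 1 := fun j k h h' => by
    rw [show 9 = 3 * 3 from rfl, pow_mul] at h' ⊢
    rw [h, h']
  match i with
  | 0 => exact key 0 2 (h₀.trans h₂.symm) e₂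
  | 1 => exact key 1 2 (h₁.trans h₂.symm) e₂
  | 2 => exact e₂
  | 3 => exact key 3 5 (h₃.trans e.symm) e₅'
  | 4 => exact key 4 5 (h₄.trans e.symm) e₅'
  | 5 => exact e₅'

/-- The splitting of the Cox group as the diagonal torus times its torsion. -/
def ltSplit (A : Type) [CommGroup A] : A × ltTorsion A ≃* ltRel A where
  toFun z := ⟨fun i => z.1 * z.2.1 i, mul_mem (const_mem_ltRel z.1) z.2.2.1⟩
  invFun t := (t.1 2 ^ 5 * (t.1 5 ^ 4)⁻¹, ⟨fun i => (t.1 2 ^ 5 * (t.1 5 ^ 4)⁻¹)⁻¹ * t.1 i,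
    mul_mem (const_mem_ltRel _) t.2, by
      change ((t.1 2 ^ 5 * (t.1 5 ^ 4)⁻¹)⁻¹ * t.1 2) ^ 5 = ((t.1 2 ^ 5 * (t.1 5 ^ 4)⁻¹)⁻¹ * t.1 5) ^ 4
      apply Additive.ofMul.injective
      simp only [ofMul_mul, ofMul_pow, ofMul_inv]
      module⟩)
  left_inv := by
    rintro ⟨c, t, ht⟩
    have h : (c * t 2) ^ 5 * ((c * t 5) ^ 4)⁻¹ = c := by
      rw [mul_pow, mul_pow, ht.2]
      apply Additive.ofMul.injective
      simp only [ofMul_mul, ofMul_pow, ofMul_inv]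
      module
    refine Prod.ext h (Subtype.ext (funext fun i => ?_))
    change ((c * t 2) ^ 5 * ((c * t 5) ^ 4)⁻¹)⁻¹ * (c * t i) = t i
    rw [h, inv_mul_cancel_left]
  right_inv t := Subtype.ext (funext fun i => mul_inv_cancel_left _ _)
  map_mul' z w := Subtype.ext (funext fun i => mul_mul_mul_comm _ _ _ _)

/-- The isomorphism `(c, g) ↦ (c g_0, …, c g_5)` onto the Cox group. -/
def ltCoxSplit (A : Type) [CommGroup A] : A × ltTorsion A ≃* CoxGroup ltFan A :=
  (ltSplit A).trans (ltCoxEquiv A).symm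

lemma coxCoord_ltCoxSplit (z : A × ltTorsion A) (i : Fin 6) :
    coxCoord ltFan A (ltCoxSplit A z) (ltRay i) = z.1 * z.2.1 i :=
  coxCoord_ltCoxEquiv_symm _ _

end LTTorsion

/-! ### Identification of the torsion with `G81` and its group structure -/

section Roots

variable {ζ₃ ζ₉ : ℂˣ}

lemma ltElt_mem_ltTorsion (h₃ : IsPrimitiveRoot ζ₃ 3) (h₉ : IsPrimitiveRoot ζ₉ 9)
    {α β δ ε μ : ℤ} (hα : ζ₉ ^ (3 * μ) = ζ₃ ^ (α + β)) (hδ : ζ₉ ^ (3 * μ) = ζ₃ ^ (δ + ε)) :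
    ltElt ζ₃ ζ₉ α β δ ε μ ∈ ltTorsion ℂˣ := by
  have e₃ : ∀ k : ℤ, (ζ₃ ^ k) ^ 3 = 1 := fun k => by
    rw [← zpow_natCast, zpow_comm, zpow_natCast, h₃.pow_eq_one, one_zpow]
  have e₉ : ∀ k : ℤ, (ζ₉ ^ k) ^ 9 = 1 := fun k => by
    rw [← zpow_natCast, zpow_comm, zpow_natCast, h₉.pow_eq_one, one_zpow]
  have e₃' : ∀ k : ℤ, ζ₃ ^ k * ζ₃ ^ k * ζ₃ ^ k = 1 := fun k => by
    rw [← e₃ k, pow_succ, pow_two]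
  rw [zpow_add] at hα hδ
  have hμ := e₉ μ
  have h3μ : ζ₉ ^ (3 * μ) = (ζ₉ ^ μ) ^ 3 := by
    rw [mul_comm, zpow_mul]; rfl
  rw [h3μ] at hα hδ
  have a₁ := e₃ α
  have a₂ := e₃ β
  have a₃ := e₃ δ
  have a₄ := e₃ ε
  refine ⟨mem_ltRel_iff.2 ⟨?_, ?_, ?_, ?_, ?_⟩, ?_⟩ <;>
  simp only [ltElt, zpow_neg] <;> simp <;>
  generalize ζ₃ ^ α = a at * <;> generalize ζ₃ ^ β = b at * <;> generalize ζ₃ ^ δ = d at * <;>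
  generalize ζ₃ ^ ε = e at * <;> generalize ζ₉ ^ μ = m at * <;>
  apply Additive.ofMul.injective <;>
  replace hα := congrArg Additive.ofMul hα <;>
  replace hδ := congrArg Additive.ofMul hδ <;>
  replace hμ := congrArg Additive.ofMul hμ <;>
  replace a₁ := congrArg Additive.ofMul a₁ <;>
  replace a₂ := congrArg Additive.ofMul a₂ <;>
  replace a₃ := congrArg Additive.ofMul a₃ <;>
  replace a₄ := congrArg Additive.ofMul a₄ <;>
  simp only [ofMul_mul, ofMul_pow, ofMul_inv, ofMul_one] at *
  · linear_combination (norm := module) a₁ + hμ - hδ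
  · linear_combination (norm := module) a₂ + hμ - hδ
  · linear_combination (norm := module) hμ - hδ
  · linear_combination (norm := module) hα - a₃ - hμ
  · linear_combination (norm := module) hα - a₄ - hμ
  · linear_combination (norm := module) hμ

/-- The coordinate `t 2` is a power of `ζ₉`, and coordinates with equal cubes differ by a power of
`ζ₃`. So every element of the kernel is already one of the generators of `G81`, and forming the
closure adds nothing. -/
lemma exists_ltElt_of_mem_ltTorsion (h₃ : IsPrimitiveRoot ζ₃ 3) (h₉ : IsPrimitiveRoot ζ₉ 9)
    {t : Fin 6 → ℂˣ} (ht : t ∈ ltTorsion ℂˣ) :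
    ∃ α β δ ε μ : ℤ, ζ₉ ^ (3 * μ) = ζ₃ ^ (α + β) ∧
      ζ₉ ^ (3 * μ) = ζ₃ ^ (δ + ε) ∧ t = ltElt ζ₃ ζ₉ α β δ ε μ := by
  have key : ∀ {n : ℕ} [NeZero n] {ζ x : ℂˣ}, IsPrimitiveRoot ζ n → x ^ n = 1 →
      ∃ k : ℤ, x = ζ ^ k := fun {n} _ {ζ x} h hx => by
    have : x ∈ Subgroup.zpowers ζ := by
      rw [h.zpowers_eq]
      exact (mem_rootsOfUnity n x).2 hx
    obtain ⟨k, hk⟩ := Subgroup.mem_zpowers_iff.1 this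
    exact ⟨k, hk.symm⟩
  have cube : ∀ {x y : ℂˣ}, x ^ 3 = y ^ 3 → ∃ k : ℤ, x = ζ₃ ^ k * y := fun {x y} h => by
    obtain ⟨k, hk⟩ := key h₃ (x := x / y) (by rw [div_pow, h, div_self'])
    exact ⟨k, by rw [← hk, div_mul_cancel]⟩
  obtain ⟨e₂, e₅, e⟩ := pow_nine_of_mem_ltTorsion ht
  obtain ⟨r₀, r₁, r₂, r₃, r₄⟩ := mem_ltRel_iff.1 ht.1
  obtain ⟨μ, hμ⟩ := key h₉ e₂
  obtain ⟨α, hα⟩ := cube (r₀.trans r₂.symm)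
  obtain ⟨β, hβ⟩ := cube (r₁.trans r₂.symm)
  obtain ⟨δ, hδ⟩ := cube (r₃.trans e.symm)
  obtain ⟨ε, hε⟩ := cube (r₄.trans e.symm)
  have h3μ : ζ₉ ^ (3 * μ) = (ζ₉ ^ μ) ^ 3 := by
    rw [mul_comm, zpow_mul]; rfl
  -- `ltElt` carries `ζ₃ ^ (-δ)` and `ζ₃ ^ (-ε)`, hence the signs.
  refine ⟨α, β, -δ, -ε, μ, ?_, ?_, ?_⟩
  · rw [h3μ, ← hμ, zpow_add]
    rw [hα, hβ, e₅] at e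
    generalize ζ₃ ^ α = a at *
    generalize ζ₃ ^ β = b at *
    apply Additive.ofMul.injective
    replace e := congrArg Additive.ofMul e
    replace e₂ := congrArg Additive.ofMul e₂
    simp only [ofMul_mul, ofMul_pow, ofMul_inv, ofMul_one] at *
    linear_combination (norm := module) e₂ + e
  · rw [h3μ, ← hμ, zpow_add, zpow_neg, zpow_neg]
    rw [hδ, hε, e₅] at r₂
    generalize ζ₃ ^ δ = a at *
    generalize ζ₃ ^ ε = b at *
    apply Additive.ofMul.injective
    replace r₂ := congrArg Additive.ofMul r₂
    replace e₂ := congrArg Additive.ofMul e₂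
    simp only [ofMul_mul, ofMul_pow, ofMul_inv, ofMul_one] at *
    linear_combination (norm := module) e₂ - r₂
  · funext i
    fin_cases i <;> simp [ltElt, ← hμ, hα, hβ, hδ, hε, e₅]

lemma G81_eq_ltTorsion (h₃ : IsPrimitiveRoot ζ₃ 3) (h₉ : IsPrimitiveRoot ζ₉ 9) :
    G81 ζ₃ ζ₉ = ltTorsion ℂˣ := by
  refine Subgroup.closure_eq_of_le _ ?_ fun t ht =>
    Subgroup.subset_closure (exists_ltElt_of_mem_ltTorsion h₃ h₉ ht)
  rintro _ ⟨α, β, δ, ε, μ, hα, hδ, rfl⟩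
  exact ltElt_mem_ltTorsion h₃ h₉ hα hδ

/-- The exponents of a ninth root of unity that parametrize `ltTorsion ℂˣ`. -/
def ltExponent : ZMod 3 × ZMod 3 × ZMod 9 →+ (Fin 6 → ZMod 9) where
  toFun z :=
    let a : ZMod 9 := 3 * (z.1.val : ZMod 9)
    let d : ZMod 9 := 3 * (z.2.1.val : ZMod 9)
    let m := z.2.2
    -- These are the exponents of `ltElt` when `ζ₃ = ζ₉ ^ 3`, with `β` and `ε` eliminated through `β
    -- = μ - α` and `ε = μ - δ` modulo 3.
    ![a + m, 4 * m - a, m, -d - m, d - 4 * m, -m]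
  map_zero' := by decide
  map_add' := by
    have h : ∀ x y : ZMod 3, (3 * ((x + y).val : ZMod 9)) = 3 * (x.val : ZMod 9) +
      3 * (y.val : ZMod 9) := by decide
    intro x y
    simp only [Prod.fst_add, Prod.snd_add, h]
    funext i
    fin_cases i <;> simp <;> ring

lemma ltExponent_injective : Function.Injective ltExponent := by
  rw [injective_iff_map_eq_zero]
  rintro ⟨a, d, m⟩ h
  have h0 : 3 * (a.val : ZMod 9) + m = 0 := congrFun h 0
  have h2 : m = 0 := congrFun h 2
  have h3 : -(3 * (d.val : ZMod 9)) - m = 0 := congrFun h 3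
  subst h2
  have h₀ : ∀ a : ZMod 3, 3 * (a.val : ZMod 9) = 0 → a = 0 := by decide
  simp only [add_zero, sub_zero, neg_eq_zero] at h0 h3
  rw [h₀ a h0, h₀ d h3]
  rfl

/-- The differences `z 0 - z 2` and `z 5 - z 3` are killed by 3, so they are multiples of 3 in `ZMod
9` and supply `a` and `d`; the linear relations determine `z 1` and `z 4`. -/
lemma exists_ltExponent_eq {z : Fin 6 → ZMod 9} (h₀ : 3 * z 0 = z 3 + z 4 + z 5)
    (h₂ : 3 * z 2 = z 3 + z 4 + z 5) (h₅ : z 5 = - z 2) (h₃ : 3 * z 3 = z 0 + z 1 + z 2)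
    (e : 3 * z 5 = z 0 + z 1 + z 2) : ∃ x, ltExponent x = z := by
  have div : ∀ x : ZMod 9, 3 * x = 0 → ∃ a : ZMod 3, x = 3 * (a.val : ZMod 9) := by decide
  obtain ⟨a, ha⟩ := div (z 0 - z 2) (by linear_combination h₀ - h₂)
  obtain ⟨d, hd⟩ := div (z 5 - z 3) (by linear_combination e - h₃)
  have h9 : (9 : ZMod 9) = 0 := rfl
  refine ⟨(a, d, z 2), funext fun i => ?_⟩
  have : ltExponent (a, d, z 2) = ![z 0 - z 2 + z 2, 4 * z 2 - (z 0 - z 2), z 2,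
    -(z 5 - z 3) - z 2, (z 5 - z 3) - 4 * z 2, - z 2] := by rw [ha, hd]; rfl
  rw [this]
  fin_cases i <;> simp
  · linear_combination e - 3 * h₅ + z 2 * h9
  · linear_combination -h₅
  · linear_combination h₂ + 2 * h₅ - z 2 * h9
  · exact h₅.symm

/-- The exponential `k ↦ ζ₉ ^ k`. -/
def zetaPow (h₉ : IsPrimitiveRoot ζ₉ 9) : Multiplicative (ZMod 9) →* ℂˣ :=
  (Subgroup.zpowers ζ₉).subtype.comp (AddMonoidHom.toMultiplicativeLeft
    h₉.zmodEquivZPowers.toAddMonoidHom)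

lemma zetaPow_injective (h₉ : IsPrimitiveRoot ζ₉ 9) : Function.Injective (zetaPow h₉) :=
  Subtype.val_injective.comp h₉.zmodEquivZPowers.injective

lemma exists_zetaPow_eq (h₉ : IsPrimitiveRoot ζ₉ 9) {x : ℂˣ} (hx : x ^ 9 = 1) :
    ∃ k : ZMod 9, zetaPow h₉ (Multiplicative.ofAdd k) = x := by
  have hx' : x ∈ Subgroup.zpowers ζ₉ := by
    rw [h₉.zpowers_eq]
    exact (mem_rootsOfUnity 9 x).2 hx
  obtain ⟨k, hk⟩ := h₉.zmodEquivZPowers.surjective (Additive.ofMul ⟨x, hx'⟩)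
  exact ⟨k, congrArg (fun y => ((Additive.toMul y : Subgroup.zpowers ζ₉) : ℂˣ)) hk⟩

lemma zetaPow_ltExponent_mem (h₉ : IsPrimitiveRoot ζ₉ 9) (x : ZMod 3 × ZMod 3 × ZMod 9) :
    (fun i => zetaPow h₉ (Multiplicative.ofAdd (ltExponent x i))) ∈ ltTorsion ℂˣ := by
  obtain ⟨a, d, m⟩ := x
  have h9 : (9 : ZMod 9) = 0 := rfl
  refine ⟨mem_ltRel_iff.2 ⟨?_, ?_, ?_, ?_, ?_⟩, ?_⟩ <;>
  simp only [← map_mul, ← map_pow, ← ofAdd_add, ← ofAdd_nsmul] <;>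
  refine congrArg (fun k => zetaPow h₉ (Multiplicative.ofAdd k)) ?_ <;>
  simp only [ltExponent, AddMonoidHom.coe_mk, ZeroHom.coe_mk] <;>
  generalize (a.val : ZMod 9) = a <;>
  generalize (d.val : ZMod 9) = d <;> simp
  · linear_combination (a + m) * h9
  · linear_combination (2 * m - a) * h9
  · linear_combination m * h9
  · linear_combination -(d + m) * h9
  · linear_combination (d - 2 * m) * h9
  · linear_combination m * h9

/-- The isomorphism type of `ltTorsion ℂˣ`. -/
def ltTorsionEquiv (h₉ : IsPrimitiveRoot ζ₉ 9) :
    Multiplicative (ZMod 3 × ZMod 3 × ZMod 9) ≃* ltTorsion ℂˣ :=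
  MulEquiv.ofBijective
    (MonoidHom.mk' (fun x : Multiplicative (ZMod 3 × ZMod 3 × ZMod 9) =>
      (⟨_, zetaPow_ltExponent_mem h₉ x.toAdd⟩ : ltTorsion ℂˣ)) fun x y => by
        ext i
        simp) <| by
    constructor
    · intro x y h
      refine Multiplicative.toAdd.injective (ltExponent_injective (funext fun i => ?_))
      exact zetaPow_injective h₉ (congrFun (congrArg Subtype.val h) i)
    · rintro ⟨t, ht⟩
      choose z hz using fun i => exists_zetaPow_eq h₉ (pow_nine_eq_one_of_mem_ltTorsion ht i)
      obtain ⟨-, e₅, e⟩ := pow_nine_of_mem_ltTorsion ht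
      obtain ⟨r₀, r₁, r₂, r₃, r₄⟩ := mem_ltRel_iff.1 ht.1
      have inj : ∀ {a b : ZMod 9}, zetaPow h₉ (Multiplicative.ofAdd a) =
        zetaPow h₉ (Multiplicative.ofAdd b) → a = b := fun h => zetaPow_injective h₉ h
      simp only [← hz, ← map_mul, ← map_pow, ← map_inv, ← ofAdd_add, ← ofAdd_nsmul, ← ofAdd_neg]
        at e₅ e r₀ r₂ r₃
      have e₅ := inj e₅
      have e := inj e
      have r₀ := inj r₀
      have r₂ := inj r₂
      have r₃ := inj r₃
      simp only [nsmul_eq_mul, Nat.cast_ofNat] at e r₀ r₂ r₃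
      obtain ⟨x, hx⟩ := exists_ltExponent_eq r₀ r₂ e₅ r₃ e
      refine ⟨Multiplicative.ofAdd x, Subtype.ext (funext fun i => ?_)⟩
      change zetaPow h₉ (Multiplicative.ofAdd (ltExponent x i)) = t i
      rw [hx, hz]

end Roots

/-! ### Roots of unity on complex schemes are locally constant -/

/-- Restriction of global functions to an open set. -/
def resTop (T : SchC) (V : T.left.Opens) : fns T →+* Γ(T.left, V) :=
  (T.left.presheaf.map (homOfLE (le_top : V ≤ ⊤)).op).hom

lemma isConstOn_iff {n : Type} {T : SchC} {t : n → (fns T)ˣ} {h : n → ℂˣ} {V : T.left.Opens} :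
    IsConstOn T t h V ↔ ∀ i, Units.map (resTop T V).toMonoidHom (t i) =
      Units.map ((resTop T V).comp (constFn T)).toMonoidHom (h i) :=
  forall_congr' fun i => (Units.ext_iff (u := Units.map (resTop T V).toMonoidHom (t i))
    (v := Units.map ((resTop T V).comp (constFn T)).toMonoidHom (h i))).symm

/-- A global function with `x ^ n = 1` is locally constant. -/
lemma exists_isConstOn_of_pow_eq_one {T : SchC} {n : ℕ} {ζ : ℂ} [NeZero n]
    (hζ : IsPrimitiveRoot ζ n) {x : (fns T)ˣ} (hx : x ^ n = 1) (p : T.left) :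
    ∃ V : T.left.Opens, p ∈ V ∧ ∃ h : ℂˣ, IsConstOn T (fun _ : Unit => x) (fun _ => h) V := by
  classical
  have hn : 0 < n := Nat.pos_of_ne_zero (NeZero.ne n)
  have hprod : ∏ c ∈ Polynomial.nthRootsFinset n (1 : ℂ), ((x : fns T) - constFn T c) = 0 := by
    have h := congrArg (Polynomial.eval₂ (constFn T) (x : fns T))
      (Polynomial.X_pow_sub_one_eq_prod hn hζ)
    rw [Polynomial.eval₂_finsetProd] at h
    simp only [Polynomial.eval₂_sub, Polynomial.eval₂_X_pow, Polynomial.eval₂_one,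
      Polynomial.eval₂_X, Polynomial.eval₂_C] at h
    rw [← h, ← Units.val_pow_eq_pow_val, hx, Units.val_one, sub_self]
  let γ := (T.left.presheaf.germ ⊤ p trivial).hom
  -- A vanishing product in the local ring at `p` has a non-unit factor, which selects the value of
  -- `x` near `p`.
  obtain ⟨c, hc, hcγ⟩ : ∃ c ∈ Polynomial.nthRootsFinset n (1 : ℂ),
      ¬ IsUnit (γ ((x : fns T) - constFn T c)) := by
    by_contra! H
    have := (IsUnit.prod_iff (s := Polynomial.nthRootsFinset n (1 : ℂ))
      (f := fun c => γ ((x : fns T) - constFn T c))).2 H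
    rw [← map_prod, hprod, map_zero] at this
    exact not_isUnit_zero this
  have hc1 : c ^ n = 1 := (Polynomial.mem_nthRootsFinset hn _).1 hc
  have hunit : ∀ c' ∈ (Polynomial.nthRootsFinset n (1 : ℂ)).erase c,
      IsUnit (γ ((x : fns T) - constFn T c')) := by
    intro c' hc'
    by_contra h
    have hne : c - c' ≠ 0 := sub_ne_zero.2 (Finset.ne_of_mem_erase hc').symm
    have h₁ : IsUnit (γ (constFn T (c - c'))) :=
      ((isUnit_iff_ne_zero.2 hne).map (constFn T)).map γ
    -- Two non-unit factors would differ by a nonzero constant, which is a unit; so all other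
    -- factors are units at `p`.
    refine IsLocalRing.nonunits_add (a := γ ((x : fns T) - constFn T c'))
      (b := -γ ((x : fns T) - constFn T c)) h (fun h => hcγ ((IsUnit.neg_iff _).1 h)) ?_
    rw [← sub_eq_add_neg, ← map_sub]
    convert h₁ using 2
    rw [map_sub]
    ring
  -- Where the product of the other factors is invertible, the vanishing of the full product forces
  -- `x = c`.
  refine ⟨T.left.basicOpen (∏ c' ∈ (Polynomial.nthRootsFinset n (1 : ℂ)).erase c,
    ((x : fns T) - constFn T c')), ?_, Units.mk0 c ?_, fun _ => ?_⟩
  · rw [Scheme.mem_basicOpen_top]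
    change IsUnit (γ _)
    rw [map_prod]
    exact (IsUnit.prod_iff).2 hunit
  · rintro rfl
    rw [zero_pow (NeZero.ne n)] at hc1
    exact zero_ne_one hc1
  · rw [← Finset.mul_prod_erase _ _ hc] at hprod
    generalize ∏ c' ∈ (Polynomial.nthRootsFinset n (1 : ℂ)).erase c,
      ((x : fns T) - constFn T c') = y at hprod
    have hy : IsUnit (resTop T (T.left.basicOpen y) y) :=
      RingedSpace.isUnit_res_basicOpen _ y
    have h := congrArg (resTop T (T.left.basicOpen y)) hprod
    rw [map_mul, map_zero] at h
    have h' := (hy.mul_left_eq_zero).1 h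
    rw [map_sub, sub_eq_zero] at h'
    exact h'

lemma eq_one_of_locally {T : SchC} {x : (fns T)ˣ}
    (h : ∀ p : T.left, ∃ V : T.left.Opens, p ∈ V ∧
      Units.map (resTop T V).toMonoidHom x = 1) : x = 1 := by
  choose V hV hx using h
  refine Units.ext ?_
  refine TopCat.Sheaf.eq_of_locally_eq' T.left.sheaf V ⊤ (fun p => homOfLE le_top) ?_ _ _ ?_
  · intro p _
    exact TopologicalSpace.Opens.mem_iSup.2 ⟨p, hV p⟩
  · intro p
    refine (congrArg Units.val (hx p)).trans ?_
    exact (map_one (resTop T (V p))).symm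

lemma ltTorsion_map {A B : Type} [CommGroup A] [CommGroup B] (f : A →* B) {t : Fin 6 → A}
    (ht : t ∈ ltTorsion A) : (fun i => f (t i)) ∈ ltTorsion B := by
  obtain ⟨h, h₅⟩ := ht
  refine ⟨?_, by simpa using congrArg f h₅⟩
  intro k
  have := congrArg f (h k)
  simpa using this

lemma ltTorsion_of_map {A B : Type} [CommGroup A] [CommGroup B] {f : A →* B}
    (hf : Function.Injective f) {t : Fin 6 → A}
    (ht : (fun i => f (t i)) ∈ ltTorsion B) : t ∈ ltTorsion A := by
  obtain ⟨h, h₅⟩ := ht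
  refine ⟨fun k => hf ?_, hf (by simpa using h₅)⟩
  have := h k
  simpa using this

lemma mem_ltTorsion_of_locally {T : SchC} {t : Fin 6 → (fns T)ˣ}
    (h : ∀ p : T.left, ∃ V : T.left.Opens, p ∈ V ∧
      (fun i => Units.map (resTop T V).toMonoidHom (t i)) ∈ ltTorsion Γ(T.left, V)ˣ) :
    t ∈ ltTorsion (fns T)ˣ := by
  refine ⟨fun k => eq_one_of_locally fun p => ?_, ?_⟩
  · obtain ⟨V, hV, h, -⟩ := h p
    refine ⟨V, hV, ?_⟩
    have := h k
    simpa using this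
  · rw [← mul_inv_eq_one]
    refine eq_one_of_locally fun p => ?_
    obtain ⟨V, hV, -, h⟩ := h p
    refine ⟨V, hV, ?_⟩
    rw [← mul_inv_eq_one] at h
    simpa using h

/-- Membership in the torsion is a system of equations between units, so it can be checked locally.
Conversely, each coordinate is a ninth root of unity, hence locally constant, and its constant
values satisfy the same equations because `ℂ` embeds in the functions on a nonempty open set. -/
lemma constPts_ltTorsion (T : SchC) : constPts (ltTorsion ℂˣ) T = ltTorsion (fns T)ˣ := by
  refine le_antisymm (fun t ht => mem_ltTorsion_of_locally fun p => ?_) (fun t ht p => ?_)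
  · obtain ⟨V, hV, h, hh, e⟩ := ht p
    refine ⟨V, hV, ?_⟩
    rw [isConstOn_iff] at e
    simp only [e]
    exact ltTorsion_map _ hh
  · have hloc := fun i => exists_isConstOn_of_pow_eq_one
      (Complex.isPrimitiveRoot_exp 9 (by norm_num)) (pow_nine_eq_one_of_mem_ltTorsion ht i) p
    choose V hV h hh using hloc
    have hp : p ∈ ⨅ i, V i := by
      rw [← SetLike.mem_coe, TopologicalSpace.Opens.coe_iInf]
      exact Set.mem_iInter.2 hV
    have e : IsConstOn T t h (⨅ i, V i) := fun i =>
      IsConstOn.mono (hh i) (iInf_le V i) ()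
    refine ⟨_, hp, h, ?_, e⟩
    -- The ring is nonzero because it maps to the stalk at `p`; a homomorphism from the field `ℂ` to
    -- it is then injective.
    have : Nontrivial Γ(T.left, ⨅ i, V i) :=
      (T.left.presheaf.germ (⨅ i, V i) p hp).hom.domain_nontrivial
    have hinj : Function.Injective ((resTop T (⨅ i, V i)).comp (constFn T)) :=
      RingHom.injective _
    refine ltTorsion_of_map (f := Units.map ((resTop T (⨅ i, V i)).comp (constFn T)).toMonoidHom)
      (Units.map_injective hinj) ?_
    rw [isConstOn_iff] at e
    simp only [← e]
    exact ltTorsion_map _ ht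

/-! ### Quotient stacks of isomorphic pairs -/

section QuotientStacks

variable {G G' : GroupFunctor} {X X' : SchCᵒᵖ ⥤ Type}

/-- Restriction of an action along a homomorphism. -/
def GAction.comap (φ : G' ⟶ G) (b : GAction G X) : GAction G' X where
  smul T g x := b.smul T ((φ.app T).hom g) x
  one_smul T x := by rw [map_one, b.one_smul]
  mul_smul T g h x := by rw [map_mul, b.mul_smul]
  map_smul {T T'} f g x := by
    have h : (φ.app T').hom (G'.map f g) = G.map f ((φ.app T).hom g) :=
      ConcreteCategory.congr_hom (φ.naturality f) g
    rw [b.map_smul, h]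

lemma inv_hom_app_apply (e : G ≅ G') (T : SchCᵒᵖ) (g : G.obj T) :
    (e.inv.app T).hom ((e.hom.app T).hom g) = g :=
  ConcreteCategory.congr_hom (e.hom_inv_id_app T) g

lemma hom_inv_app_apply (e : G ≅ G') (T : SchCᵒᵖ) (g : G'.obj T) :
    (e.hom.app T).hom ((e.inv.app T).hom g) = g :=
  ConcreteCategory.congr_hom (e.inv_hom_id_app T) g

variable {a : GAction G X} {a' : GAction G' X'}

lemma isPullback_id_id {C : Type*} [Category C] {x y : C} (f : x ⟶ y) :
    IsPullback (𝟙 x) f f (𝟙 y) :=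
  IsPullback.of_horiz_isIso ⟨by simp⟩

/-- An isomorphism of pairs `(G, X) ≅ (G', X')` of a group functor and a functor it acts on. -/
structure GIso (a : GAction G X) (a' : GAction G' X') where
  grp : G ≅ G'
  space : X ≅ X'
  smul : ∀ T (g : G.obj T) (x : X.obj T),
    space.hom.app T (a.smul T g x) = a'.smul T ((grp.hom.app T).hom g) (space.hom.app T x)

/-- The inverse of an isomorphism of pairs. -/
def GIso.symm (i : GIso a a') : GIso a' a where
  grp := i.grp.symm
  space := i.space.symm
  smul T g x := by
    have h := congrArg (i.space.inv.app T)
      (i.smul T ((i.grp.inv.app T).hom g) (i.space.inv.app T x))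
    rw [hom_inv_app_apply] at h
    have h₁ : ∀ y, i.space.inv.app T (i.space.hom.app T y) = y := fun y =>
      ConcreteCategory.congr_hom (i.space.hom_inv_id_app T) y
    have h₂ : ∀ y, i.space.hom.app T (i.space.inv.app T y) = y := fun y =>
      ConcreteCategory.congr_hom (i.space.inv_hom_id_app T) y
    rw [h₁, h₂] at h
    exact h.symm

/-- Transport of objects of quotient stacks along an isomorphism of pairs. -/
def GIso.mapObj (i : GIso a a') (P : QuotObj G X a) : QuotObj G' X' a' where
  base := P.base
  total := P.total
  proj := P.proj
  act := P.act.comap i.grp.inv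
  act_proj T g p := P.act_proj T _ p
  flat := P.flat
  surjective := P.surjective
  finitePresentation := P.finitePresentation
  simply_transitive T p q h := by
    obtain ⟨g, hg, hu⟩ := P.simply_transitive T p q h
    refine ⟨(i.grp.hom.app (op T)).hom g, ?_, fun g' hg' => ?_⟩
    · change P.act.smul (op T) ((i.grp.inv.app _).hom ((i.grp.hom.app _).hom g)) p = q
      rw [inv_hom_app_apply, hg]
    · rw [← hu _ hg', hom_inv_app_apply]
  toX := P.toX ≫ i.space.hom
  equivariant T g p := by
    change i.space.hom.app (op T) (P.toX.app (op T) (P.act.smul (op T) _ p)) =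
      a'.smul (op T) g (i.space.hom.app (op T) (P.toX.app (op T) p))
    rw [P.equivariant, i.smul, hom_inv_app_apply]

/-- Transport along an isomorphism of pairs as a functor. -/
def GIso.mapFunctor (i : GIso a a') : QuotObj G X a ⥤ QuotObj G' X' a' where
  obj := i.mapObj
  map {P Q} f :=
    { onBase := f.onBase
      onTotal := f.onTotal
      cartesian := f.cartesian
      equivariant := fun T _ p => f.equivariant T _ p
      comp_toX := by
        change yoneda.map f.onTotal ≫ Q.toX ≫ i.space.hom = P.toX ≫ i.space.hom
        rw [← Category.assoc, f.comp_toX] }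
  map_id _ := rfl
  map_comp _ _ := rfl

/-- Transport back and forth along an isomorphism of pairs. -/
def GIso.mapObjSymm (i : GIso a a') (Q : QuotObj G' X' a') : i.mapObj (i.symm.mapObj Q) ≅ Q where
  hom :=
    { onBase := 𝟙 Q.base
      onTotal := 𝟙 Q.total
      cartesian := isPullback_id_id Q.proj
      equivariant := fun T g (p : T ⟶ Q.total) => by
        change Q.act.smul (op T) ((i.grp.hom.app _).hom ((i.grp.inv.app _).hom g)) p ≫ 𝟙 Q.total =
          Q.act.smul (op T) g (p ≫ 𝟙 Q.total)
        rw [hom_inv_app_apply, Category.comp_id p]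
        exact Category.comp_id _
      comp_toX := by
        change yoneda.map (𝟙 Q.total) ≫ Q.toX = (Q.toX ≫ i.space.inv) ≫ i.space.hom
        simp }
  inv :=
    { onBase := 𝟙 Q.base
      onTotal := 𝟙 Q.total
      cartesian := isPullback_id_id Q.proj
      equivariant := fun T g (p : T ⟶ Q.total) => by
        change Q.act.smul (op T) g p ≫ 𝟙 Q.total =
          Q.act.smul (op T) ((i.grp.hom.app _).hom ((i.grp.inv.app _).hom g)) (p ≫ 𝟙 Q.total)
        rw [hom_inv_app_apply, Category.comp_id p]
        exact Category.comp_id _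
      comp_toX := by
        change yoneda.map (𝟙 Q.total) ≫ (Q.toX ≫ i.space.inv) ≫ i.space.hom = Q.toX
        simp }
  hom_inv_id := QuotHom.ext (Category.id_comp _) (Category.id_comp _)
  inv_hom_id := QuotHom.ext (Category.id_comp _) (Category.id_comp _)

/-- Transport keeps the bundle and the underlying maps of a morphism, so faithfulness is immediate.
For fullness, equivariance is tested on the image of `g` under the group isomorphism, and the
isomorphism of spaces is cancelled from the maps to `X'`. -/
lemma GIso.isEquivalence_mapFunctor (i : GIso a a') : i.mapFunctor.IsEquivalence where
  faithful := ⟨fun {P Q f g} h => QuotHom.ext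
    (congrArg (fun k : i.mapFunctor.obj P ⟶ i.mapFunctor.obj Q => QuotHom.onBase k) h)
    (congrArg (fun k : i.mapFunctor.obj P ⟶ i.mapFunctor.obj Q => QuotHom.onTotal k) h)⟩
  full := ⟨fun {P Q} f => ⟨
    { onBase := f.onBase
      onTotal := f.onTotal
      cartesian := f.cartesian
      equivariant := fun T g p => by
        have h : (P.act.smul (op T) ((i.grp.inv.app _).hom ((i.grp.hom.app _).hom g)) p :
            T ⟶ P.total) ≫ f.onTotal =
            Q.act.smul (op T) ((i.grp.inv.app _).hom ((i.grp.hom.app _).hom g))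
              (p ≫ f.onTotal) := f.equivariant T ((i.grp.hom.app (op T)).hom g) p
        rwa [inv_hom_app_apply] at h
      comp_toX := by
        let t : P.total ⟶ Q.total := f.onTotal
        have h : yoneda.map t ≫ Q.toX ≫ i.space.hom = P.toX ≫ i.space.hom := f.comp_toX
        exact (cancel_mono i.space.hom).1 ((Category.assoc _ _ _).trans h) }, rfl⟩⟩
  essSurj := ⟨fun Q => ⟨i.symm.mapObj Q, ⟨i.mapObjSymm Q⟩⟩⟩

lemma GIso.isStackIso (i : GIso a a') : IsStackIso (quotStack G X a) (quotStack G' X' a') :=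
  ⟨{ toFunctor := i.mapFunctor, w := rfl }, i.isEquivalence_mapFunctor⟩

end QuotientStacks

/-! ### The isomorphism of group schemes and of stacks -/

section LT

variable {ζ₃ ζ₉ : ℂˣ}

/-- The coordinates give an isomorphism of `𝔾_m × G_81` with the Cox group, on `T`-points. -/
def gmTimesEquiv (h₃ : IsPrimitiveRoot ζ₃ 3) (h₉ : IsPrimitiveRoot ζ₉ 9) (T : SchC) :
    (fns T)ˣ × constPts (G81 ζ₃ ζ₉) T ≃* CoxGroup ltFan (fns T)ˣ :=
  ((MulEquiv.refl _).prodCongr (MulEquiv.subgroupCongr (by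
    rw [G81_eq_ltTorsion h₃ h₉, constPts_ltTorsion]))).trans (ltCoxSplit (fns T)ˣ)

lemma coxCoord_gmTimesEquiv (h₃ : IsPrimitiveRoot ζ₃ 3) (h₉ : IsPrimitiveRoot ζ₉ 9) (T : SchC)
    (z : (fns T)ˣ × constPts (G81 ζ₃ ζ₉) T) (i : Fin 6) :
    coxCoord ltFan (fns T)ˣ (gmTimesEquiv h₃ h₉ T z) (ltRay i) = z.1 * z.2.1 i :=
  coxCoord_ltCoxSplit _ _

/-- The isomorphism of group schemes `𝔾_m × G_81 ≅ G_Σ`. -/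
def gmTimesIso (h₃ : IsPrimitiveRoot ζ₃ 3) (h₉ : IsPrimitiveRoot ζ₉ 9) :
    gmTimes (G81 ζ₃ ζ₉) ≅ coxGroupFunctor ltFan :=
  NatIso.ofComponents (fun T => (gmTimesEquiv h₃ h₉ T.unop).toGrpIso) fun {T T'} f => by
    refine GrpCat.hom_ext (MonoidHom.ext fun z => ?_)
    -- Naturality can be checked in coordinates, where the map is `z.1 * z.2.1 i` and commutes with
    -- pullback.
    refine coxCoord_injective ltFan (funext fun ρ => ?_)
    obtain ⟨i, rfl⟩ := ltRay.surjective ρ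
    have h₁ := coxCoord_gmTimesEquiv h₃ h₉ T'.unop ((gmTimes (G81 ζ₃ ζ₉)).map f z) i
    have h₂ := congrArg (Units.map (pull f.unop).toMonoidHom)
      (coxCoord_gmTimesEquiv h₃ h₉ T.unop z i)
    rw [map_mul] at h₂
    exact h₁.trans h₂.symm

lemma weight_gmTimesIso (h₃ : IsPrimitiveRoot ζ₃ 3) (h₉ : IsPrimitiveRoot ζ₉ 9) (T : SchCᵒᵖ)
    (z : (gmTimes (G81 ζ₃ ζ₉)).obj T) (i : Fin 6) :
    weight (coxWeights ltFan) T ((gmTimesIso h₃ h₉).hom.app T z) (ltRay i) =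
      weight (gmTimesWeights (G81 ζ₃ ζ₉)) T z i :=
  coxCoord_gmTimesEquiv h₃ h₉ T.unop z i

/-- The Cox open set of the Libgober–Teitelbaum fan is the punctured affine space. -/
def coxOpenIso : coordOpenPts (puncturedSets (Fin 6)) ≅ coordOpenPts (coxSets ltFan) :=
  Iso.symm <| NatIso.ofComponents (fun T => Equiv.toIso
    { toFun := fun x => ⟨fun i => x.1 (ltRay i), by
        rw [← preimage_coordOpen_coxSets_ltFan, x.2]⟩
      invFun := fun x => ⟨fun ρ => x.1 (ltRay.symm ρ), by
        rw [preimage_coordOpen_coxSets_ltFan]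
        simp only [Equiv.symm_apply_apply, x.2]⟩
      left_inv := fun x => Subtype.ext (funext fun ρ => congrArg x.1 (ltRay.apply_symm_apply ρ))
      right_inv := fun x => Subtype.ext (funext fun i => congrArg x.1 (ltRay.symm_apply_apply i)) })
    fun _ => rfl

/-- The isomorphism of group schemes respects the actions on the Cox open set. -/
def ltGIso (h₃ : IsPrimitiveRoot ζ₃ 3) (h₉ : IsPrimitiveRoot ζ₉ 9) :
    GIso (scaleAction (gmTimesWeights (G81 ζ₃ ζ₉)) (puncturedSets (Fin 6)))
      (scaleAction (coxWeights ltFan) (coxSets ltFan)) where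
  grp := gmTimesIso h₃ h₉
  space := coxOpenIso
  smul T g x := by
    refine Subtype.ext (funext fun ρ => ?_)
    obtain ⟨i, rfl⟩ := ltRay.surjective ρ
    have h := weight_gmTimesIso h₃ h₉ T g i
    change ((weight (gmTimesWeights (G81 ζ₃ ζ₉)) T g (ltRay.symm (ltRay i)) : (fns T.unop)ˣ) :
      fns T.unop) * x.1 (ltRay.symm (ltRay i)) =
      (weight (coxWeights ltFan) T ((gmTimesIso h₃ h₉).hom.app T g) (ltRay i) : (fns T.unop)ˣ) *
        x.1 (ltRay.symm (ltRay i))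
    rw [h, Equiv.symm_apply_apply]

end LT

end

theorem proposition3p3 (ζ₃ ζ₉ : ℂˣ) (h₃ : IsPrimitiveRoot ζ₃ 3) (h₉ : IsPrimitiveRoot ζ₉ 9) :
    -- `Σ_LT` is a fan, whose maximal cones are the cones on five of the six generators
    IsFan ltFan ∧
    (∀ σ : PointedCone ℝ (Fin 5 → ℝ), Maximal (· ∈ ltFan) σ ↔
      ∃ I : Finset (Fin 6), I.card = 5 ∧ σ = latticeCone ltVec I) ∧
    -- it has the six rays `ρ_0, …, ρ_5`, with the given primitive generators
    (∃ ρ : Fin 6 ≃ rays ltFan,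
      (∀ i, IsPrimGen (ρ i).1 (ltVec i)) ∧
      -- the Cox open set is `𝔸^6 ∖ {0}`
      (∀ (T : SchC) (x : rays ltFan → fns T),
        toAffine T x ⁻¹ᵁ coordOpen (coxSets ltFan) = ⊤ ↔
          toAffine T (fun i => x (ρ i)) ⁻¹ᵁ coordOpen (puncturedSets (Fin 6)) = ⊤) ∧
      -- the Cox group is `ℂˣ × G_81`, with the prescribed action on the coordinates
      (∃ φ : (ℂˣ × G81 ζ₃ ζ₉) ≃* CoxGroup ltFan ℂˣ,
        ∀ (c : ℂˣ) (g : G81 ζ₃ ζ₉) (i : Fin 6),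
          coxCoord ltFan ℂˣ (φ (c, g)) (ρ i) = c * g.1 i) ∧
      -- and likewise as group schemes
      (∃ Φ : gmTimes (G81 ζ₃ ζ₉) ≅ coxGroupFunctor ltFan,
        ∀ (T : SchCᵒᵖ) (z : (gmTimes (G81 ζ₃ ζ₉)).obj T) (i : Fin 6),
          weight (coxWeights ltFan) T (Φ.hom.app T z) (ρ i) =
            weight (gmTimesWeights (G81 ζ₃ ζ₉)) T z i)) ∧
    -- `G_81` has the stated isomorphism type
    Nonempty (G81 ζ₃ ζ₉ ≃* Multiplicative (ZMod 3 × ZMod 3 × ZMod 9)) ∧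
    -- the Cox stack is the Libgober–Teitelbaum stack
    IsStackIso (coxStack ltFan) (ltStack ζ₃ ζ₉) := by
  have hG : G81 ζ₃ ζ₉ = ltTorsion ℂˣ := G81_eq_ltTorsion h₃ h₉
  refine ⟨isFan_ltFan, fun σ => maximal_mem_ltFan_iff, ⟨ltRay, isPrimGen_ltRay, fun T x => ?_,
    ⟨((MulEquiv.refl _).prodCongr (MulEquiv.subgroupCongr hG)).trans (ltCoxSplit ℂˣ),
      fun c g i => coxCoord_ltCoxSplit _ _⟩, gmTimesIso h₃ h₉, weight_gmTimesIso h₃ h₉⟩,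
    ⟨(MulEquiv.subgroupCongr hG).trans (ltTorsionEquiv h₉).symm⟩, (ltGIso h₃ h₉).symm.isStackIso⟩
  rw [preimage_coordOpen_coxSets_ltFan]
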